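/- **Conventions.** Let $\mathbb H$ be the real quaternions with units $i,j,k$ and modulus $|q|_Q=\sqrt{q\bar q}$, and let $|\cdot|$ be the Euclidean norm on $\mathbb R^2$. For $g\in L^1(\mathbb R^2,\mathbb H)$ the two-sided quaternion Fourier transform is $$\mathcal F\{g\}(\xi)=\int_{\mathbb R^2}e^{-2\pi i\,\xi_1x_1}\,g(x)\,e^{-2\pi j\,\xi_2x_2}\,dx ,$$ and, for $f=f_0+if_1+jf_2+kf_3$ with $f_0,\dots,f_3$ real-valued, $$\|\mathcal F\{f\}(\xi)\|_Q:=\Big(\sum_{m=0}^{3}|\mathcal F\{f_m\}(\xi)|_Q^2\Big)^{1/2}.$$ **Corollary 5.3 (Gelfand–Shilov type).** Let $d\in\mathbb N=\{0,1,2,\dots\}$, let $\alpha,\beta\ge 1$, and let $1<p,q<\infty$ with $\frac1p+\frac1q=1$. Suppose that $f\in L^2(\mathbb R^2,\mathbb H)$ satisfies $$\int_{\mathbb R^2}\frac{|f(x)|_Q}{(1+|x|)^d}\,e^{2\pi\frac{\alpha^p}{p}|x|^p}\,dx<\infty,\qquad \int_{\mathbb R^2}\frac{\|\mathcal F\{f\}(y)\|_Q}{(1+|y|)^d}\,e^{2\pi\frac{\beta^q}{q}|y|^q}\,dy<\infty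 .$$ (The first condition implies $f\in L^1(\mathbb R^2,\mathbb H)$, so $\mathcal F$ is given by the integral above.) Then: 1. if $(p,q)\ne(2,2)$ or $\alpha\beta>1$, then $f=0$ almost everywhere; 2. otherwise, $f(x)=P(x)\,e^{-\pi\alpha^2|x|^2}$ for almost every $x\in\mathbb R^2$, where $P$ is a polynomial in $x_1,x_2$ with coefficients in $\mathbb H$ and $\deg P<d-2$ (with $\deg 0=-\infty$, so that $f=0$ almost everywhere when $d\le 2$). -/

import Mathlib

noncomputable section

namespace QuaternionFourier

/-- The plane with its Euclidean norm and Lebesgue measure. -/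
abbrev Plane : Type := EuclideanSpace ℝ (Fin 2)

/-- The quaternion exponential `e^{iθ} = cos θ + i sin θ`. -/
def expI (θ : ℝ) : Quaternion ℝ := ⟨Real.cos θ, Real.sin θ, 0, 0⟩

/-- The quaternion exponential `e^{jθ} = cos θ + j sin θ`. -/
def expJ (θ : ℝ) : Quaternion ℝ := ⟨Real.cos θ, 0, Real.sin θ, 0⟩

/-- The two-sided quaternion Fourier transform of an integrable function:
`𝓕{f}(ξ) = ∫ e^{-i 2π ξ₁ x₁} f(x) e^{-j 2π ξ₂ x₂} dx`. -/
def qft (f : Plane → Quaternion ℝ) (ξ : Plane) : Quaternion ℝ :=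
  ∫ x : Plane, expI (-(2 * Real.pi * ξ 0 * x 0)) * f x * expJ (-(2 * Real.pi * ξ 1 * x 1))

/-- The modulus `‖𝓕{f}‖_Q` at `ξ`: the square root of the sum of the `|𝓕{f_m}(ξ)|²` over the
four real components `f_0, …, f_3` of `f`, each regarded as a quaternion-valued function.
(It depends on `f`, and is not in general the quaternion modulus of `𝓕{f}(ξ)`.) -/
def qftModulus (f : Plane → Quaternion ℝ) (ξ : Plane) : ℝ :=
  Real.sqrt
    (‖qft (fun x => (((f x).re : ℝ) : Quaternion ℝ)) ξ‖ ^ 2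
      + ‖qft (fun x => (((f x).imI : ℝ) : Quaternion ℝ)) ξ‖ ^ 2
      + ‖qft (fun x => (((f x).imJ : ℝ) : Quaternion ℝ)) ξ‖ ^ 2
      + ‖qft (fun x => (((f x).imK : ℝ) : Quaternion ℝ)) ξ‖ ^ 2)

/-- Polynomials in two real variables with quaternion coefficients, given by their coefficients:
`P (m, n)` is the coefficient of `x₁^m x₂^n`.  (Mathlib's `MvPolynomial` requires commutative
coefficients.) -/
abbrev QPoly : Type := (ℕ × ℕ) →₀ Quaternion ℝ

/-- The value `P(x) = ∑ x₁^m x₂^n P_{m,n}` at a point of the plane. -/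
def QPoly.eval (P : QPoly) (x : Plane) : Quaternion ℝ :=
  P.sum fun s a => (x 0 ^ s.1 * x 1 ^ s.2) • a

/-- The total degree, with `deg 0 = ⊥` (that is, `-∞`). -/
def QPoly.degree (P : QPoly) : WithBot ℕ :=
  P.support.sup fun s => ((s.1 + s.2 : ℕ) : WithBot ℕ)

end QuaternionFourier

end

namespace QuaternionFourier

open Complex Set Filter Topology MeasureTheory FourierTransform

/-! The problem reduces to complex scalar functions. For a real component `f_m`, a real-linear map
of norm at most √2 carries the two-sided transform to the classical Fourier transform
(`norm_fourier_le_qft`), so each component satisfies the two weighted integrability conditions with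
the classical 𝓕 (`gelfandShilov_component`).

For a scalar `v` with weight `exp(2π β^q |y|^q / q)`, the sharp Young inequality shows that 𝓕v
extends to an entire function along every line, of size at most `exp(b |Im z|^p)` up to a polynomial
factor, with `b = 2π / (p β^p)` (`norm_fourierSlice_le`). The weight on 𝓕v gives, by Fubini,
weighted integrability on almost every line parallel to an axis. Everything then rests on entire
functions `h` of one variable for which both statements hold with the same `b`. Passing to a
primitive turns integrability on the real line into pointwise bounds, to which Phragmén–Lindelöf
applies.

If `p = 2`, a primitive of `h(z) exp(b z²)` has polynomial growth on the real line and at most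
`exp(b (Re z)²)` elsewhere, again up to polynomial factors. Hence it has polynomial growth
everywhere and is a polynomial (`gaussian_line`). When the decay exceeds the critical rate the
primitive is bounded on a half-line, so it is constant and `h = 0` (`gaussian_line_eq_zero`).

If `1 < p < 2`, a primitive of `h` tends to a limit at rate `exp(-b x^p)` along the half-line and
grows at most like `exp(b r^p)` on the imaginary axis. The extremal indicator with these values
vanishes on the bisecting ray, so the primitive has polynomial growth on all four diagonals. As its
order is below 2, it has polynomial growth everywhere; being bounded on a half-line it is constant,
and `h = 0` (`morgan_line`).

One of `p`, `q` is below 2 unless both equal 2, and `u` and 𝓕u exchange roles through inversion, so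
this covers all cases. In the critical case, polynomiality in each variable gives joint
polynomiality by Lagrange interpolation. The degree bound follows from integrability in polar
coordinates (`QPoly.degree_lt_of_integrable`). -/

/-! ### Entire functions of polynomial growth, and primitives. -/

/-- An entire function of polynomial growth is a polynomial. -/
theorem exists_polynomial_of_growth {f : ℂ → ℂ} (hf : Differentiable ℂ f) {M : ℝ} {N : ℕ}
    (h : ∀ z, ‖f z‖ ≤ M * (1 + ‖z‖) ^ N) :
    ∃ P : Polynomial ℂ, P.natDegree ≤ N ∧ ∀ z, f z = P.eval z := by
  have hM : 0 ≤ M := by simpa using (norm_nonneg _).trans (h 0)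
  have hder : ∀ n, N < n → iteratedDeriv n f 0 = 0 := by
    intro n hn
    -- Cauchy's estimate on the circle of radius `R`; since `n ≥ N + 1`, a factor `R⁻¹` is left
    -- over.
    have hb : ∀ R : ℝ, 1 ≤ R → ‖iteratedDeriv n f 0‖ ≤ n.factorial * (M * 2 ^ N) * R⁻¹ := by
      intro R hR
      have h1 := norm_iteratedDeriv_le_of_forall_mem_sphere_norm_le n (c := 0) (f := f)
        (C := M * (2 * R) ^ N) (lt_of_lt_of_le one_pos hR) hf.diffContOnCl (fun z hz => by
          refine (h z).trans ?_
          have : ‖z‖ = R := by simpa using hz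
          gcongr
          linarith)
      refine h1.trans ?_
      have hR0 : 0 < R := by linarith
      have : R ^ N * R ≤ R ^ n := by
        rw [← pow_succ]; exact pow_le_pow_right₀ hR hn
      rw [mul_assoc, mul_div_assoc]
      have h2 : M * (2 * R) ^ N / R ^ n ≤ M * 2 ^ N * R⁻¹ := by
        rw [div_le_iff₀ (by positivity), mul_pow]
        calc M * (2 ^ N * R ^ N) = M * 2 ^ N * R⁻¹ * (R ^ N * R) := by field_simp
          _ ≤ _ := by gcongr
      have := mul_le_mul_of_nonneg_left h2 (Nat.cast_nonneg (α := ℝ) n.factorial)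
      linarith
    have hl : Tendsto (fun R : ℝ => n.factorial * (M * 2 ^ N) * R⁻¹) atTop (𝓝 0) := by
      simpa using tendsto_inv_atTop_zero.const_mul (n.factorial * (M * 2 ^ N))
    have := ge_of_tendsto hl ((eventually_ge_atTop 1).mono hb)
    simpa using this
  refine ⟨∑ n ∈ Finset.range (N + 1),
    Polynomial.monomial n ((n.factorial : ℂ)⁻¹ * iteratedDeriv n f 0), ?_, fun z => ?_⟩
  · refine Polynomial.natDegree_sum_le_of_forall_le _ _ fun i hi => ?_
    exact (Polynomial.natDegree_monomial_le _).trans (by simpa [Nat.lt_succ_iff] using hi)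
  · have := Complex.taylorSeries_eq_of_entire' (c := 0) (z := z) hf
    rw [← this, tsum_eq_sum (s := Finset.range (N + 1))]
    · simp [Polynomial.eval_finsetSum]
    · intro n hn
      rw [hder n (by simpa using hn)]; simp

/-- An entire function of polynomial growth that is bounded on a half-line is constant. -/
theorem deriv_eq_zero_of_growth_of_bounded {f : ℂ → ℂ} (hf : Differentiable ℂ f) {M K : ℝ} {N : ℕ}
    (h : ∀ z, ‖f z‖ ≤ M * (1 + ‖z‖) ^ N) (hK : ∀ x : ℝ, 0 ≤ x → ‖f x‖ ≤ K) (z : ℂ) :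
    deriv f z = 0 := by
  obtain ⟨P, -, hP⟩ := exists_polynomial_of_growth hf h
  have hf' : f = fun z => P.eval z := funext hP
  by_cases hd : 0 < P.degree
  · exfalso
    have h1 : Tendsto (fun x : ℝ => ‖P.eval (x : ℂ)‖) atTop atTop := by
      refine Polynomial.tendsto_norm_atTop P hd ?_
      simpa using tendsto_abs_atTop_atTop
    obtain ⟨x, hx1, hx2⟩ := ((h1.eventually_gt_atTop K).and (eventually_ge_atTop 0)).exists
    have := hK x hx2
    rw [hP] at this
    linarith
  · rw [hf', Polynomial.eq_C_of_degree_le_zero (not_lt.1 hd)]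
    simp

theorem exists_primitive {f : ℂ → ℂ} (hf : Differentiable ℂ f) :
    ∃ A : ℂ → ℂ, A 0 = 0 ∧ ∀ z, HasDerivAt A (f z) z := by
  obtain ⟨g, h0, hg⟩ := hf.isExactOn_univ.with_val_at 0 0
  exact ⟨g, h0, fun z => hg z (mem_univ z)⟩

/-- The mean value inequality on a rectangle. A rectangle, unlike a disc, preserves bounds that
depend on `|Re z|` or `|Im z|` alone. -/
theorem primitive_norm_le {A f : ℂ → ℂ} (hA0 : A 0 = 0) (hA : ∀ z, HasDerivAt A (f z) z) {z : ℂ}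
    {C : ℝ} (hC : ∀ w : ℂ, |w.re| ≤ |z.re| → |w.im| ≤ |z.im| → ‖f w‖ ≤ C) :
    ‖A z‖ ≤ C * ‖z‖ := by
  have hs : Convex ℝ (Icc (-|z.re|) |z.re| ×ℂ Icc (-|z.im|) |z.im|) :=
    ((convex_Icc _ _).linear_preimage reLm).inter
      ((convex_Icc _ _).linear_preimage imLm)
  have := hs.norm_image_sub_le_of_norm_hasDerivWithin_le (f := A) (f' := f) (C := C) (x := 0)
    (y := z) (fun w _ => (hA w).hasDerivWithinAt)
    (fun w hw => hC w (abs_le.2 hw.1) (abs_le.2 hw.2))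
    ⟨by simp, by simp⟩ ⟨abs_le.1 le_rfl, abs_le.1 le_rfl⟩
  simpa [hA0] using this

theorem primitive_eq_integral {A f : ℂ → ℂ} (hA : ∀ z, HasDerivAt A (f z) z)
    (hf : Continuous f) (a b : ℝ) : ∫ t in a..b, f t = A b - A a := by
  refine intervalIntegral.integral_eq_sub_of_hasDerivAt (f := fun t : ℝ => A t) (fun t _ => ?_)
    (hf.comp continuous_ofReal).continuousOn.intervalIntegrable
  exact (hA t).comp_ofReal

theorem one_add_norm_le {z : ℂ} (hz : 0 ≤ z.re) : 1 + ‖z‖ ≤ 2 * ‖1 + z‖ := by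
  have h1 : ‖z‖ ≤ ‖1 + z‖ := by
    rw [Complex.norm_def, Complex.norm_def]
    refine Real.sqrt_le_sqrt ?_
    simp [normSq_apply]; nlinarith
  have h2 : 1 ≤ ‖1 + z‖ := by
    refine le_trans ?_ (Complex.re_le_norm _)
    simp [hz]
  linarith

/-! ### Phragmén–Lindelöf in sectors. -/

theorem norm_exp_rot (b E p ρ θ : ℝ) :
    ‖cexp ((b + E * I) * cexp (p * (ρ + θ * I)))‖
      = Real.exp (Real.exp (p * ρ) * (b * Real.cos (p * θ) - E * Real.sin (p * θ))) := by
  rw [Complex.norm_exp]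
  congr 1
  simp [Complex.exp_re, Complex.exp_im]
  ring

/-- Phragmén–Lindelöf in a sector of opening `θ₀`, in logarithmic coordinates, with respect to the
exponent `r ^ p (E sin pθ - b cos pθ)`. -/
theorem sector_bound {p b E B θ₀ M : ℝ} {N : ℕ} {G : ℂ → ℂ} (hG : Differentiable ℂ G)
    (hθ0 : 0 < θ₀) (hθ1 : θ₀ ≤ Real.pi / 2) (hp : 0 ≤ p) (hpθ : p * θ₀ < Real.pi) (hM : 0 ≤ M)
    (hB : 0 ≤ B)
    (hre : ∀ ρ : ℝ, ‖G (cexp ρ)‖ ≤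
      M * (1 + Real.exp ρ) ^ N * Real.exp (-(b * Real.exp (p * ρ))))
    (hup : ∀ ρ : ℝ, ‖G (cexp (ρ + θ₀ * I))‖ ≤ M * (1 + Real.exp ρ) ^ N *
      Real.exp (Real.exp (p * ρ) * (E * Real.sin (p * θ₀) - b * Real.cos (p * θ₀))))
    (hgr : ∀ ρ θ : ℝ, 0 ≤ θ → θ ≤ θ₀ → ‖G (cexp (ρ + θ * I))‖ ≤
      M * (1 + Real.exp ρ) ^ N * Real.exp (B * Real.exp (p * ρ)))
    {ρ θ : ℝ} (h0 : 0 ≤ θ) (h1 : θ ≤ θ₀) :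
    ‖G (cexp (ρ + θ * I))‖ ≤ M * 2 ^ N * (1 + Real.exp ρ) ^ N *
      Real.exp (Real.exp (p * ρ) * (E * Real.sin (p * θ) - b * Real.cos (p * θ))) := by
  -- With `w = exp ζ`, the sector becomes a strip and `w ^ p = exp (p ζ)` is entire, so no branch is
  -- needed. The factor `exp((b + iE) w^p)` cancels the expected indicator and `(1 + w)^N` the
  -- polynomial growth; as `θ₀ ≤ π/2`, `Re w ≥ 0` and `|1 + w|` is comparable to `1 + |w|`.
  set K : ℂ → ℂ := fun ζ => G (cexp ζ) * cexp ((b + E * I) * cexp (p * ζ)) / (1 + cexp ζ) ^ N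
    with hK
  have hre0 : ∀ ζ : ℂ, 0 ≤ ζ.im → ζ.im ≤ θ₀ → 0 ≤ (cexp ζ).re := by
    intro ζ h0 h1
    rw [exp_re]
    exact mul_nonneg (Real.exp_pos _).le (Real.cos_nonneg_of_mem_Icc ⟨by linarith, by linarith⟩)
  have hden : ∀ ζ : ℂ, 0 ≤ ζ.im → ζ.im ≤ θ₀ → (1 + ‖cexp ζ‖) ^ N ≤ 2 ^ N * ‖(1 + cexp ζ) ^ N‖ := by
    intro ζ h0 h1
    rw [norm_pow, ← mul_pow]
    exact pow_le_pow_left₀ (by positivity) (one_add_norm_le (hre0 ζ h0 h1)) _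
  have hden0 : ∀ ζ : ℂ, 0 ≤ ζ.im → ζ.im ≤ θ₀ → 0 < ‖(1 + cexp ζ) ^ N‖ := by
    intro ζ h0 h1
    have := hden ζ h0 h1
    have h3 : 0 < (1 + ‖cexp ζ‖) ^ N := by positivity
    by_contra h4
    have h5 : ‖(1 + cexp ζ) ^ N‖ = 0 := le_antisymm (not_lt.1 h4) (norm_nonneg _)
    rw [h5] at this; linarith
  have hnK : ∀ (ρ θ : ℝ), ‖K (ρ + θ * I)‖ = ‖G (cexp (ρ + θ * I))‖ *
      Real.exp (Real.exp (p * ρ) * (b * Real.cos (p * θ) - E * Real.sin (p * θ)))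
        / ‖(1 + cexp (ρ + θ * I)) ^ N‖ := by
    intro ρ θ
    rw [hK]; simp only
    rw [norm_div, norm_mul, norm_exp_rot]
  have hne : ∀ (ρ θ : ℝ), ‖cexp (ρ + θ * I)‖ = Real.exp ρ := by
    intro ρ θ; simp [Complex.norm_exp]
  have hKle : ∀ (ρ θ a c : ℝ), 0 ≤ θ → θ ≤ θ₀ →
      ‖G (cexp (ρ + θ * I))‖ ≤ M * (1 + Real.exp ρ) ^ N * Real.exp a →
      a + Real.exp (p * ρ) * (b * Real.cos (p * θ) - E * Real.sin (p * θ)) ≤ c →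
      ‖K (ρ + θ * I)‖ ≤ M * 2 ^ N * Real.exp c := by
    intro ρ θ a c h0 h1 h2 h3
    have hd := hden (ρ + θ * I) (by simpa using h0) (by simpa using h1)
    have hd0 := hden0 (ρ + θ * I) (by simpa using h0) (by simpa using h1)
    rw [hne] at hd
    rw [hnK, div_le_iff₀ hd0]
    calc _ ≤ M * (1 + Real.exp ρ) ^ N * Real.exp a * Real.exp (Real.exp (p * ρ) *
          (b * Real.cos (p * θ) - E * Real.sin (p * θ))) := by gcongr
      _ = M * (1 + Real.exp ρ) ^ N * Real.exp (a + Real.exp (p * ρ) *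
          (b * Real.cos (p * θ) - E * Real.sin (p * θ))) := by rw [Real.exp_add]; ring
      _ ≤ M * (2 ^ N * ‖(1 + cexp (ρ + θ * I)) ^ N‖) * Real.exp c := by gcongr
      _ = _ := by ring
  have hmain : ‖K (ρ + θ * I)‖ ≤ M * 2 ^ N := by
    refine PhragmenLindelof.horizontal_strip (a := 0) (b := θ₀) (f := K) ?_ ?_ ?_ ?_
      (by simpa using h0) (by simpa using h1)
    · refine DifferentiableOn.diffContOnCl fun ζ hζ => ?_
      have hcl : closure (im ⁻¹' Ioo 0 θ₀) ⊆ im ⁻¹' Icc 0 θ₀ :=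
        closure_minimal (preimage_mono Ioo_subset_Icc_self) (isClosed_Icc.preimage continuous_im)
      have hζ' := hcl hζ
      refine DifferentiableAt.differentiableWithinAt ?_
      refine DifferentiableAt.div ?_ (by fun_prop) ?_
      · exact ((hG _).comp ζ (by fun_prop)).mul (by fun_prop)
      · exact norm_pos_iff.1 (hden0 ζ hζ'.1 hζ'.2)
    · refine ⟨p, ?_, B + |b| + |E|, ?_⟩
      · rw [sub_zero, lt_div_iff₀ hθ0]; exact hpθ
      · refine Asymptotics.IsBigO.of_bound (M * 2 ^ N) ?_
        refine eventually_inf_principal.2 (Eventually.of_forall fun ζ hζ => ?_)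
        have hζe : ζ = (ζ.re : ℂ) + ζ.im * I := (re_add_im ζ).symm
        rw [Real.norm_of_nonneg (Real.exp_pos _).le]
        conv_lhs => rw [hζe]
        refine hKle _ _ _ _ hζ.1.le hζ.2.le (hgr _ _ hζ.1.le hζ.2.le) ?_
        have he : Real.exp (p * ζ.re) ≤ Real.exp (p * |ζ.re|) := by
          gcongr; exact le_abs_self _
        have h5 : b * Real.cos (p * ζ.im) ≤ |b| := by
          refine (le_abs_self _).trans ?_
          rw [abs_mul]
          simpa using mul_le_mul_of_nonneg_left (Real.abs_cos_le_one (p * ζ.im)) (abs_nonneg b)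
        have h6 : -(E * Real.sin (p * ζ.im)) ≤ |E| := by
          refine (neg_le_abs _).trans ?_
          rw [abs_mul]
          simpa using mul_le_mul_of_nonneg_left (Real.abs_sin_le_one (p * ζ.im)) (abs_nonneg E)
        calc _ = Real.exp (p * ζ.re) * (B + b * Real.cos (p * ζ.im)
              + -(E * Real.sin (p * ζ.im))) := by ring
          _ ≤ Real.exp (p * ζ.re) * (B + |b| + |E|) := by gcongr
          _ ≤ Real.exp (p * |ζ.re|) * (B + |b| + |E|) := by gcongr
          _ = _ := by ring
    · intro ζ hζ
      have hζe : ζ = (ζ.re : ℂ) + (0 : ℝ) * I := by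
        rw [← hζ]; exact (re_add_im ζ).symm
      rw [hζe]
      have := hKle ζ.re 0 (-(b * Real.exp (p * ζ.re))) 0 le_rfl hθ0.le (by
        simpa using hre ζ.re) (by simp; linarith)
      simpa using this
    · intro ζ hζ
      have hζe : ζ = (ζ.re : ℂ) + (θ₀ : ℝ) * I := by
        rw [← hζ]; exact (re_add_im ζ).symm
      rw [hζe]
      have := hKle ζ.re θ₀ _ 0 hθ0.le le_rfl (hup _) (by linarith)
      simpa using this
  have hd0 := hden0 (ρ + θ * I) (by simpa using h0) (by simpa using h1)
  rw [hnK, div_le_iff₀ hd0] at hmain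
  have hup : ‖(1 + cexp (ρ + θ * I)) ^ N‖ ≤ (1 + Real.exp ρ) ^ N := by
    rw [norm_pow]
    refine pow_le_pow_left₀ (norm_nonneg _) ?_ _
    refine (norm_add_le _ _).trans ?_
    rw [hne]; simp
  have hinv : Real.exp (Real.exp (p * ρ) * (E * Real.sin (p * θ) - b * Real.cos (p * θ)))
      = (Real.exp (Real.exp (p * ρ) * (b * Real.cos (p * θ) - E * Real.sin (p * θ))))⁻¹ := by
    rw [← Real.exp_neg]; congr 1; ring
  rw [hinv, ← div_eq_mul_inv, le_div_iff₀ (Real.exp_pos _)]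
  exact hmain.trans (by gcongr)

theorem norm_cexp_polar (ρ θ : ℝ) : ‖cexp (ρ + θ * I)‖ = Real.exp ρ := by
  simp [Complex.norm_exp]

theorem exists_log_polar {z : ℂ} (hz : z ≠ 0) : z = cexp (Real.log ‖z‖ + arg z * I) := by
  conv_lhs => rw [← exp_log hz, Complex.log]

/-! ### The Gaussian case on a line. -/

/-- The quadrant is exactly critical for order 2, so Phragmén–Lindelöf is applied to `A(z) exp(-b
z²)` in sectors of opening `θ₀ < π/2`. The resulting error in the exponent is proportional to `cot
θ₀` and vanishes as `θ₀ → π/2`. -/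
theorem gaussian_quadrant {b M : ℝ} {N : ℕ} {A : ℂ → ℂ} (hA : Differentiable ℂ A) (hb : 0 ≤ b)
    (hre : ∀ x : ℝ, ‖A x‖ ≤ M * (1 + |x|) ^ N)
    (hgr : ∀ z : ℂ, ‖A z‖ ≤ M * (1 + ‖z‖) ^ N * Real.exp (b * z.re ^ 2))
    {z : ℂ} (h0 : 0 ≤ z.re) (h1 : 0 ≤ z.im) :
    ‖A z‖ ≤ M * 2 ^ N * (1 + ‖z‖) ^ N := by
  have hM : 0 ≤ M := by simpa using (norm_nonneg _).trans (hre 0)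
  have h2N : (1 : ℝ) ≤ 2 ^ N := one_le_pow₀ (by norm_num)
  rcases h0.eq_or_lt with h0 | h0
  · have := hgr z
    rw [← h0] at this
    simp only [ne_eq, OfNat.ofNat_ne_zero, not_false_eq_true, zero_pow, mul_zero, Real.exp_zero,
      mul_one] at this
    refine this.trans ?_
    gcongr
    nlinarith
  have hz0 : z ≠ 0 := by rintro rfl; simp at h0
  set r := ‖z‖ with hr
  set ρ := Real.log r with hρ
  have hr0 : 0 < r := norm_pos_iff.2 hz0
  have hρr : Real.exp ρ = r := Real.exp_log hr0
  set θ := arg z with hθ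
  have hzp : z = cexp (ρ + θ * I) := exists_log_polar hz0
  have hθ0 : 0 ≤ θ := arg_nonneg_iff.2 h1
  have hθ1 : θ < Real.pi / 2 := arg_lt_pi_div_two_iff.2 (Or.inl h0)
  set G : ℂ → ℂ := fun w => A w * cexp (-(b * w ^ 2)) with hG
  have hGn : ∀ ρ θ : ℝ, ‖G (cexp (ρ + θ * I))‖ = ‖A (cexp (ρ + θ * I))‖ *
      Real.exp (-(b * (Real.exp (2 * ρ) * Real.cos (2 * θ)))) := by
    intro ρ θ
    rw [hG]; simp only
    rw [norm_mul, Complex.norm_exp, ← Complex.exp_nat_mul]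
    congr 2
    simp [Complex.exp_re]
  have hsq : ∀ ρ : ℝ, Real.exp (2 * ρ) = Real.exp ρ ^ 2 := by
    intro ρ; rw [← Real.exp_nat_mul]; norm_num
  have hGd : Differentiable ℂ G := by
    rw [hG]; exact hA.mul (by fun_prop)
  have hgr' : ∀ ρ θ : ℝ, ‖A (cexp (ρ + θ * I))‖ ≤ M * (1 + Real.exp ρ) ^ N *
      Real.exp (b * (Real.exp (2 * ρ) * Real.cos θ ^ 2)) := by
    intro ρ θ
    refine (hgr _).trans ?_
    rw [norm_cexp_polar, hsq, ← mul_pow]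
    simp [Complex.exp_re]
  have key : ∀ θ₀ : ℝ, θ < θ₀ → θ₀ < Real.pi / 2 → ‖A z‖ ≤ M * 2 ^ N * (1 + r) ^ N *
      Real.exp (Real.exp (2 * ρ) * ((b * Real.cos θ₀ / (2 * Real.sin θ₀)) * Real.sin (2 * θ))) := by
    intro θ₀ h2 h3
    have hθ00 : 0 < θ₀ := lt_of_le_of_lt hθ0 h2
    have hs : 0 < Real.sin θ₀ := Real.sin_pos_of_pos_of_lt_pi hθ00 (by linarith [Real.pi_pos])
    -- `E` solves `E sin 2θ₀ - b cos 2θ₀ = b cos² θ₀ - b cos 2θ₀`, the exponent known on the upper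
    -- ray.
    have := sector_bound (p := 2) (b := b) (E := b * Real.cos θ₀ / (2 * Real.sin θ₀)) (B := 2 * b)
      (θ₀ := θ₀) (M := M) (N := N) (G := G) hGd hθ00 h3.le (by norm_num) (by linarith)
      hM (by positivity) (fun ρ => by
        have h := hGn ρ 0
        have h' := hre (Real.exp ρ)
        simp only [ofReal_zero, zero_mul, add_zero, mul_zero, Real.cos_zero, mul_one,
          abs_of_pos (Real.exp_pos ρ), ofReal_exp] at h h'
        rw [h]
        gcongr)
      (fun ρ => by
        rw [hGn]
        have h := mul_le_mul_of_nonneg_right (hgr' ρ θ₀)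
          (Real.exp_pos (-(b * (Real.exp (2 * ρ) * Real.cos (2 * θ₀))))).le
        refine h.trans_eq ?_
        rw [mul_assoc, ← Real.exp_add]
        congr 2
        rw [Real.sin_two_mul]
        field_simp
        ring)
      (fun ρ θ h4 h5 => by
        rw [hGn]
        have h := mul_le_mul_of_nonneg_right (hgr' ρ θ)
          (Real.exp_pos (-(b * (Real.exp (2 * ρ) * Real.cos (2 * θ))))).le
        refine h.trans ?_
        rw [mul_assoc, ← Real.exp_add]
        gcongr
        have h6 : Real.cos θ ^ 2 - Real.cos (2 * θ) ≤ 2 := by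
          nlinarith [Real.neg_one_le_cos (2 * θ), Real.sin_sq_add_cos_sq θ, sq_nonneg (Real.sin θ)]
        have := mul_le_mul_of_nonneg_left h6 (mul_nonneg hb (Real.exp_pos (2 * ρ)).le)
        linarith)
      (ρ := ρ) (θ := θ) hθ0 h2.le
    rw [hGn, ← hzp, hρr] at this
    have h7 := mul_le_mul_of_nonneg_right this
      (Real.exp_pos (b * (Real.exp (2 * ρ) * Real.cos (2 * θ)))).le
    rw [mul_assoc, ← Real.exp_add, neg_add_cancel, Real.exp_zero, mul_one, mul_assoc,
      ← Real.exp_add] at h7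
    refine h7.trans_eq ?_
    congr 2
    ring
  have hlim : Tendsto (fun θ₀ : ℝ => M * 2 ^ N * (1 + r) ^ N *
      Real.exp (Real.exp (2 * ρ) * ((b * Real.cos θ₀ / (2 * Real.sin θ₀)) * Real.sin (2 * θ))))
      (𝓝[<] (Real.pi / 2)) (𝓝 (M * 2 ^ N * (1 + r) ^ N)) := by
    have : ContinuousAt (fun θ₀ : ℝ => M * 2 ^ N * (1 + r) ^ N *
      Real.exp (Real.exp (2 * ρ) * ((b * Real.cos θ₀ / (2 * Real.sin θ₀)) * Real.sin (2 * θ))))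
      (Real.pi / 2) := by
      have : 2 * Real.sin (Real.pi / 2) ≠ 0 := by simp
      fun_prop (disch := assumption)
    have h := this.tendsto.mono_left (nhdsWithin_le_nhds (s := Iio (Real.pi / 2)))
    simpa using h
  refine ge_of_tendsto hlim ?_
  filter_upwards [Ioo_mem_nhdsLT hθ1] with θ₀ h
  exact key θ₀ h.1 h.2

theorem gaussian_plane {b M : ℝ} {N : ℕ} {A : ℂ → ℂ} (hA : Differentiable ℂ A) (hb : 0 ≤ b)
    (hre : ∀ x : ℝ, ‖A x‖ ≤ M * (1 + |x|) ^ N)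
    (hgr : ∀ z : ℂ, ‖A z‖ ≤ M * (1 + ‖z‖) ^ N * Real.exp (b * z.re ^ 2)) (z : ℂ) :
    ‖A z‖ ≤ M * 2 ^ N * (1 + ‖z‖) ^ N := by
  have half : ∀ {A : ℂ → ℂ}, Differentiable ℂ A → (∀ x : ℝ, ‖A x‖ ≤ M * (1 + |x|) ^ N) →
      (∀ z : ℂ, ‖A z‖ ≤ M * (1 + ‖z‖) ^ N * Real.exp (b * z.re ^ 2)) → ∀ z : ℂ, 0 ≤ z.im →
      ‖A z‖ ≤ M * 2 ^ N * (1 + ‖z‖) ^ N := by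
    intro A hA hre hgr z h1
    rcases le_total 0 z.re with h0 | h0
    · exact gaussian_quadrant hA hb hre hgr h0 h1
    · have hd : Differentiable ℂ fun w => (starRingEnd ℂ) (A (-(starRingEnd ℂ) w)) :=
        fun w => (differentiableAt_conj_conj_iff (f := fun w => A (-w))).2
          ((hA.comp differentiable_neg) _)
      have := gaussian_quadrant (A := fun w => (starRingEnd ℂ) (A (-(starRingEnd ℂ) w))) hd hb
        (fun x => by simpa using hre (-x)) (fun w => by simpa using hgr (-(starRingEnd ℂ) w))
        (z := -(starRingEnd ℂ) z) (by simpa using h0) (by simpa using h1)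
      simpa using this
  rcases le_total 0 z.im with h1 | h1
  · exact half hA hre hgr z h1
  · have := half (A := fun w => A (-w)) (hA.comp differentiable_neg)
      (fun x => by simpa using hre (-x)) (fun w => by simpa using hgr (-w)) (-z) (by simpa using h1)
    simpa using this

theorem one_add_pow_mul_exp_le (d : ℕ) {c p : ℝ} (hc : 0 < c) (hp : 1 ≤ p) :
    ∃ C, 0 < C ∧ ∀ s : ℝ, 0 ≤ s → (1 + s) ^ d * Real.exp (-(c * s ^ p)) ≤ C := by
  refine ⟨d.factorial / c ^ d * Real.exp (2 * c), by positivity, fun s hs => ?_⟩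
  have h1 : (c * (1 + s)) ^ d / d.factorial ≤ Real.exp (c * (1 + s)) :=
    Real.pow_div_factorial_le_exp _ (by positivity) _
  have h2 : s - 1 ≤ s ^ p := by
    rcases le_total 1 s with h | h
    · have := Real.rpow_le_rpow_of_exponent_le h hp
      rw [Real.rpow_one] at this
      linarith
    · have := Real.rpow_nonneg hs p
      linarith
  have h3 : Real.exp (-(c * s ^ p)) ≤ Real.exp (2 * c) * Real.exp (-(c * (1 + s))) := by
    rw [← Real.exp_add]
    gcongr
    nlinarith
  have h4 : (1 + s) ^ d ≤ d.factorial / c ^ d * Real.exp (c * (1 + s)) := by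
    rw [mul_pow, div_le_iff₀ (by positivity)] at h1
    rw [div_mul_eq_mul_div, le_div_iff₀ (by positivity)]
    linarith
  calc _ ≤ (d.factorial / c ^ d * Real.exp (c * (1 + s))) *
        (Real.exp (2 * c) * Real.exp (-(c * (1 + s)))) := by gcongr
    _ = d.factorial / c ^ d * Real.exp (2 * c) *
        (Real.exp (c * (1 + s)) * Real.exp (-(c * (1 + s)))) := by ring
    _ = _ := by rw [← Real.exp_add]; simp

/-- The Gaussian case on a line: the primitive of `h(z) e^{b z²}` has polynomial growth. -/
theorem exists_primitive_growth {b C : ℝ} {N d : ℕ} {h : ℂ → ℂ} (hh : Differentiable ℂ h)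
    (hb : 0 ≤ b)
    (hgr : ∀ z, ‖h z‖ ≤ C * (1 + |z.im|) ^ N * Real.exp (b * z.im ^ 2))
    (hint : Integrable fun x : ℝ => ‖h x‖ / (1 + |x|) ^ d * Real.exp (b * x ^ 2)) :
    ∃ A : ℂ → ℂ, ∃ M : ℝ, A 0 = 0 ∧ (∀ z, HasDerivAt A (h z * cexp (b * z ^ 2)) z) ∧
      ∀ z, ‖A z‖ ≤ M * (1 + ‖z‖) ^ (N + d + 1) := by
  have hHd : Differentiable ℂ fun z => h z * cexp (b * z ^ 2) := hh.mul (by fun_prop)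
  obtain ⟨A, hA0, hA⟩ := exists_primitive hHd
  have hC : 0 ≤ C := by simpa using (norm_nonneg _).trans (hgr 0)
  set J := ∫ x : ℝ, ‖h x‖ / (1 + |x|) ^ d * Real.exp (b * x ^ 2) with hJ
  have hw0 : ∀ x : ℝ, 0 ≤ ‖h x‖ / (1 + |x|) ^ d * Real.exp (b * x ^ 2) := fun x => by positivity
  have hJ0 : 0 ≤ J := integral_nonneg hw0
  -- On the real line the integrability hypothesis becomes a pointwise bound; the weight `(1 +
  -- |t|)^d` is at most `(1 + |x|)^d` on the path from 0 to `x`.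
  have hre : ∀ x : ℝ, ‖A x‖ ≤ J * (1 + |x|) ^ d := by
    intro x
    have h1 := primitive_eq_integral hA hHd.continuous 0 x
    rw [ofReal_zero, hA0, sub_zero] at h1
    rw [← h1]
    refine intervalIntegral.norm_integral_le_integral_norm_uIoc.trans ?_
    rw [mul_comm, ← integral_const_mul]
    refine le_trans ?_ (setIntegral_le_integral (s := uIoc 0 x) (hint.const_mul _)
      (Eventually.of_forall fun t => mul_nonneg (by positivity) (hw0 t)))
    refine setIntegral_mono_on ?_ (hint.const_mul _).integrableOn measurableSet_uIoc ?_
    · exact ((hHd.continuous.comp continuous_ofReal).norm.integrableOn_uIcc).mono_set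
        uIoc_subset_uIcc
    · intro t ht
      have htx : |t| ≤ |x| := by
        have := abs_sub_left_of_mem_uIcc (uIoc_subset_uIcc ht)
        simpa using this
      rw [norm_mul, Complex.norm_exp]
      have : (b * (t : ℂ) ^ 2).re = b * t ^ 2 := by
        rw [← ofReal_pow, ← ofReal_mul, ofReal_re]
      rw [this]
      have h2 : ‖h t‖ ≤ (1 + |x|) ^ d * (‖h t‖ / (1 + |t|) ^ d) := by
        rw [mul_div_assoc', le_div_iff₀ (by positivity), mul_comm]
        gcongr
      calc _ ≤ (1 + |x|) ^ d * (‖h t‖ / (1 + |t|) ^ d) * Real.exp (b * t ^ 2) := by gcongr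
        _ = _ := by ring
  have hH : ∀ w : ℂ, ‖h w * cexp (b * w ^ 2)‖ ≤
      C * (1 + |w.im|) ^ N * Real.exp (b * w.re ^ 2) := by
    intro w
    rw [norm_mul, Complex.norm_exp]
    have : (b * w ^ 2).re = b * w.re ^ 2 - b * w.im ^ 2 := by
      simp [sq, Complex.mul_re]; ring
    rw [this]
    have h1 := mul_le_mul_of_nonneg_right (hgr w) (Real.exp_pos (b * w.re ^ 2 - b * w.im ^ 2)).le
    refine h1.trans_eq ?_
    rw [mul_assoc, ← Real.exp_add]
    congr 2; ring
  have hgrA : ∀ z : ℂ, ‖A z‖ ≤ C * (1 + ‖z‖) ^ (N + 1) * Real.exp (b * z.re ^ 2) := by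
    intro z
    have h1 := primitive_norm_le (C := C * (1 + ‖z‖) ^ N * Real.exp (b * z.re ^ 2)) hA0 hA
      (z := z) (fun w hw1 hw2 => by
        refine (hH w).trans ?_
        gcongr C * (1 + ?_) ^ N * Real.exp (b * ?_)
        · exact hw2.trans (abs_im_le_norm z)
        · exact sq_le_sq.2 hw1)
    refine h1.trans ?_
    rw [pow_succ (1 + ‖z‖)]
    calc _ ≤ C * (1 + ‖z‖) ^ N * Real.exp (b * z.re ^ 2) * (1 + ‖z‖) := by
          gcongr
          linarith
      _ = _ := by ring
  have hAd : Differentiable ℂ A := fun z => (hA z).differentiableAt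
  refine ⟨A, (J + C) * 2 ^ (N + d + 1), hA0, hA, fun z => ?_⟩
  refine gaussian_plane hAd hb (fun x => ?_) (fun z => ?_) z
  · refine (hre x).trans ?_
    have : (1 : ℝ) ≤ 1 + |x| := by linarith [abs_nonneg x]
    gcongr
    · linarith
    · omega
  · refine (hgrA z).trans ?_
    have : (1 : ℝ) ≤ 1 + ‖z‖ := by linarith [norm_nonneg z]
    gcongr
    · linarith
    · omega

theorem gaussian_line {b C : ℝ} {N d : ℕ} {h : ℂ → ℂ} (hh : Differentiable ℂ h) (hb : 0 ≤ b)
    (hgr : ∀ z, ‖h z‖ ≤ C * (1 + |z.im|) ^ N * Real.exp (b * z.im ^ 2))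
    (hint : Integrable fun x : ℝ => ‖h x‖ / (1 + |x|) ^ d * Real.exp (b * x ^ 2)) :
    ∃ P : Polynomial ℂ, P.natDegree ≤ N + d ∧ ∀ z, h z * cexp (b * z ^ 2) = P.eval z := by
  obtain ⟨A, M, -, hA, hM⟩ := exists_primitive_growth hh hb hgr hint
  obtain ⟨P, hP, hAP⟩ := exists_polynomial_of_growth (fun z => (hA z).differentiableAt) hM
  refine ⟨Polynomial.derivative P, ?_, fun z => ?_⟩
  · have := Polynomial.natDegree_derivative_le P
    omega
  · rw [← (hA z).deriv, funext hAP, Polynomial.deriv]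

/-- With no polynomial loss in the weight, the primitive of `h(z) exp(b z²)` is bounded on the
positive half-line by the full integral, so it is constant. -/
theorem gaussian_line_eq_zero {b C : ℝ} {N : ℕ} {h : ℂ → ℂ} (hh : Differentiable ℂ h) (hb : 0 ≤ b)
    (hgr : ∀ z, ‖h z‖ ≤ C * (1 + |z.im|) ^ N * Real.exp (b * z.im ^ 2))
    (hint : Integrable fun x : ℝ => ‖h x‖ * Real.exp (b * x ^ 2)) (z : ℂ) : h z = 0 := by
  obtain ⟨A, M, hA0, hA, hM⟩ := exists_primitive_growth (d := 0) hh hb hgr (by simpa using hint)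
  have hHd : Differentiable ℂ fun z => h z * cexp (b * z ^ 2) := hh.mul (by fun_prop)
  have := deriv_eq_zero_of_growth_of_bounded (fun z => (hA z).differentiableAt) hM
    (K := ∫ x : ℝ, ‖h x‖ * Real.exp (b * x ^ 2)) (fun x hx => by
      have h1 := primitive_eq_integral hA hHd.continuous 0 x
      rw [ofReal_zero, hA0, sub_zero] at h1
      rw [← h1]
      refine intervalIntegral.norm_integral_le_integral_norm_uIoc.trans ?_
      refine le_trans (le_of_eq ?_) (setIntegral_le_integral (s := uIoc 0 x) hint
        (Eventually.of_forall fun t => by positivity))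
      refine setIntegral_congr_fun measurableSet_uIoc fun t _ => ?_
      simp only [norm_mul, Complex.norm_exp]
      rw [← ofReal_pow, ← ofReal_mul, ofReal_re]) z
  rw [(hA z).deriv] at this
  simpa using this

/-! ### The Morgan case on a line: order below 2. -/

theorem exp_mul_eq_rpow (p ρ : ℝ) : Real.exp (p * ρ) = Real.exp ρ ^ p := by
  rw [← Real.exp_mul, mul_comm]

/-- An entire function of order less than `2` with polynomial growth on both axes has polynomial
growth. -/
theorem growth_of_axes {p b M : ℝ} {K : ℕ} {G : ℂ → ℂ} (hG : Differentiable ℂ G)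
    (hp0 : 0 ≤ p) (hp : p < 2) (hb : 0 ≤ b)
    (hgr : ∀ z, ‖G z‖ ≤ M * (1 + ‖z‖) ^ K * Real.exp (b * ‖z‖ ^ p))
    (hax : ∀ z : ℂ, z.re = 0 ∨ z.im = 0 → ‖G z‖ ≤ M * (1 + ‖z‖) ^ K) (z : ℂ) :
    ‖G z‖ ≤ M * 2 ^ K * (1 + ‖z‖) ^ K := by
  have hM : 0 ≤ M := by simpa using (norm_nonneg _).trans (hax 0 (by simp))
  have h2K : (1 : ℝ) ≤ 2 ^ K := one_le_pow₀ (by norm_num)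
  have quad : ∀ {G : ℂ → ℂ}, Differentiable ℂ G →
      (∀ z, ‖G z‖ ≤ M * (1 + ‖z‖) ^ K * Real.exp (b * ‖z‖ ^ p)) →
      (∀ z : ℂ, z.re = 0 ∨ z.im = 0 → ‖G z‖ ≤ M * (1 + ‖z‖) ^ K) →
      ∀ z : ℂ, 0 ≤ z.re → 0 ≤ z.im → ‖G z‖ ≤ M * 2 ^ K * (1 + ‖z‖) ^ K := by
    intro G hG hgr hax z h0 h1
    by_cases hz : z = 0
    · refine (hax z (by simp [hz])).trans ?_
      gcongr
      nlinarith
    have hzp := exists_log_polar hz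
    have := sector_bound (p := p) (b := 0) (E := 0) (B := b) (θ₀ := Real.pi / 2) (M := M) (N := K)
      hG (by positivity) le_rfl hp0 (by nlinarith [Real.pi_pos]) hM hb
      (fun ρ => by
        have := hax (cexp ρ) (Or.inr (by simp [Complex.exp_im]))
        simpa [Complex.norm_exp] using this)
      (fun ρ => by
        have := hax (cexp (ρ + (Real.pi / 2 : ℝ) * I)) (Or.inl (by simp [Complex.exp_re]))
        rw [norm_cexp_polar] at this
        simpa using this)
      (fun ρ θ _ _ => by
        have := hgr (cexp (ρ + θ * I))
        rwa [norm_cexp_polar, ← exp_mul_eq_rpow] at this)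
      (ρ := Real.log ‖z‖) (θ := arg z) (arg_nonneg_iff.2 h1)
      (arg_le_pi_div_two_iff.2 (Or.inl h0))
    rw [← hzp, Real.exp_log (norm_pos_iff.2 hz)] at this
    simpa using this
  rcases le_total 0 z.re with h0 | h0 <;> rcases le_total 0 z.im with h1 | h1
  · exact quad hG hgr hax z h0 h1
  · have := quad (G := fun w => G (-I * w)) (hG.comp (by fun_prop))
      (fun w => by simpa using hgr (-I * w))
      (fun w hw => by
        simpa using hax (-I * w) (by simpa using hw.symm)) (I * z) (by simpa using h1)
        (by simpa using h0)
    simpa [← mul_assoc] using this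
  · have := quad (G := fun w => G (I * w)) (hG.comp (by fun_prop))
      (fun w => by simpa using hgr (I * w))
      (fun w hw => by
        simpa using hax (I * w) (by simpa using hw.symm)) (-I * z) (by simpa using h1)
        (by simpa using h0)
    simpa [← mul_assoc] using this
  · have := quad (G := fun w => G (-w)) (hG.comp (by fun_prop))
      (fun w => by simpa using hgr (-w))
      (fun w hw => by
        simpa using hax (-w) (by simpa using hw)) (-z) (by simpa using h0)
        (by simpa using h1)
    simpa using this

theorem growth_of_diagonals {p b M : ℝ} {K : ℕ} {B : ℂ → ℂ} (hB : Differentiable ℂ B)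
    (hp0 : 0 ≤ p) (hp : p < 2) (hb : 0 ≤ b)
    (hgr : ∀ z, ‖B z‖ ≤ M * (1 + ‖z‖) ^ K * Real.exp (b * ‖z‖ ^ p))
    (hax : ∀ z : ℂ, |z.re| = |z.im| → ‖B z‖ ≤ M * (1 + ‖z‖) ^ K) (z : ℂ) :
    ‖B z‖ ≤ M * 2 ^ K * (1 + ‖z‖) ^ K := by
  set u : ℂ := cexp ((Real.pi / 4 : ℝ) * I) with hu
  have hun : ‖u‖ = 1 := norm_exp_ofReal_mul_I _
  have hu0 : u ≠ 0 := Complex.exp_ne_zero _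
  have hure : u.re = √2 / 2 := by rw [hu, exp_ofReal_mul_I_re, Real.cos_pi_div_four]
  have huim : u.im = √2 / 2 := by rw [hu, exp_ofReal_mul_I_im, Real.sin_pi_div_four]
  have := growth_of_axes (G := fun w => B (w * u)) (hB.comp (by fun_prop)) hp0 hp hb
    (M := M) (K := K) (fun w => by simpa [hun] using hgr (w * u)) (fun w hw => by
      have := hax (w * u) (by
        rw [mul_re, mul_im, hure, huim]
        rcases hw with hw | hw <;> simp [hw])
      simpa [hun] using this) (z / u)
  simpa [hun, div_mul_cancel₀ _ hu0] using this

/-- Phragmén–Lindelöf in the whole first quadrant, applied to the tail `c₀ - B` with `c₀` the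
integral of `h` over the half-line. The exponent is `-b r^p` on the real side and `b r^p` on the
imaginary side; by symmetry of the indicator about the bisector it is 0 at angle `π/4`. The
conclusions concern `B` and not the tail, since `c₀` changes from one quadrant to another. -/
theorem primitive_diagonal_bound {p b C : ℝ} {N d : ℕ} {h B : ℂ → ℂ} (hh : Differentiable ℂ h)
    (hp1 : 1 < p) (hp : p < 2) (hb : 0 < b)
    (hgr : ∀ z, ‖h z‖ ≤ C * (1 + |z.im|) ^ N * Real.exp (b * |z.im| ^ p))
    (hint : Integrable fun x : ℝ => ‖h x‖ / (1 + |x|) ^ d * Real.exp (b * |x| ^ p))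
    (hB0 : B 0 = 0) (hB : ∀ z, HasDerivAt B (h z) z) :
    ∃ M, 0 ≤ M ∧ (∀ x : ℝ, 0 ≤ x → ‖B x‖ ≤ M) ∧
      (∀ z, ‖B z‖ ≤ M * (1 + ‖z‖) ^ (N + d + 1) * Real.exp (b * ‖z‖ ^ p)) ∧
      ∀ z : ℂ, 0 ≤ z.re → z.re = z.im → ‖B z‖ ≤ M * (1 + ‖z‖) ^ (N + d + 1) := by
  have hp0 : 0 < p := by linarith
  have hC : 0 ≤ C := by
    have := (norm_nonneg _).trans (hgr 0)
    simpa [Real.zero_rpow hp0.ne'] using this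
  obtain ⟨C', hC'0, hC'⟩ := one_add_pow_mul_exp_le d hb hp1.le
  set w : ℝ → ℝ := fun x => ‖h x‖ / (1 + |x|) ^ d * Real.exp (b * |x| ^ p) with hw
  have hw0 : ∀ x, 0 ≤ w x := fun x => by positivity
  set J := ∫ x : ℝ, w x with hJ
  have hJ0 : 0 ≤ J := integral_nonneg hw0
  -- Superadditivity `x^p + s^p ≤ (x + s)^p` extracts the decay `exp(-b x^p)`, and the remaining
  -- `exp(-b s^p)` absorbs `(1 + s)^d`.
  have hhw : ∀ x t : ℝ, 0 ≤ x → x ≤ |t| →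
      ‖h t‖ ≤ C' * (1 + x) ^ d * Real.exp (-(b * x ^ p)) * w t := by
    intro x t hx hxt
    set s := |t| - x with hs
    have hs0 : 0 ≤ s := by linarith
    have h1 : (1 + |t|) ^ d ≤ (1 + x) ^ d * (1 + s) ^ d := by
      rw [← mul_pow]
      gcongr
      nlinarith
    have h2 : b * x ^ p + b * s ^ p ≤ b * |t| ^ p := by
      have := Real.add_rpow_le_rpow_add hx hs0 hp1.le
      rw [← mul_add]
      gcongr
      simpa [hs] using this
    have h3 : ‖h t‖ = w t * ((1 + |t|) ^ d * Real.exp (-(b * |t| ^ p))) := by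
      rw [hw]; simp only
      rw [Real.exp_neg]
      field_simp
    rw [h3]
    have h4 : (1 + |t|) ^ d * Real.exp (-(b * |t| ^ p)) ≤
        (1 + x) ^ d * (1 + s) ^ d * (Real.exp (-(b * x ^ p)) * Real.exp (-(b * s ^ p))) := by
      rw [← Real.exp_add]
      gcongr
      linarith
    calc _ ≤ w t * ((1 + x) ^ d * (1 + s) ^ d *
          (Real.exp (-(b * x ^ p)) * Real.exp (-(b * s ^ p)))) := by
            exact mul_le_mul_of_nonneg_left h4 (hw0 t)
      _ = w t * ((1 + x) ^ d * Real.exp (-(b * x ^ p)) *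
          ((1 + s) ^ d * Real.exp (-(b * s ^ p)))) := by ring
      _ ≤ w t * ((1 + x) ^ d * Real.exp (-(b * x ^ p)) * C') := by
          refine mul_le_mul_of_nonneg_left ?_ (hw0 t)
          gcongr
          exact hC' s hs0
      _ = _ := by ring
  have hhint : Integrable fun x : ℝ => h x := by
    refine (hint.const_mul C').mono' (hh.continuous.comp continuous_ofReal).aestronglyMeasurable
      (Eventually.of_forall fun t => ?_)
    simpa [Real.zero_rpow hp0.ne'] using hhw 0 t le_rfl (abs_nonneg t)
  set c₀ : ℂ := ∫ t in Ioi (0 : ℝ), h t with hc₀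
  have htail : ∀ x : ℝ, 0 ≤ x → c₀ - B x = ∫ t in Ioi x, h t := by
    intro x hx
    have h1 := primitive_eq_integral hB hh.continuous 0 x
    rw [ofReal_zero, hB0, sub_zero] at h1
    have h2 := intervalIntegral.integral_interval_add_Ioi (a := 0) (b := x)
      (f := fun t : ℝ => h t) hhint.integrableOn hhint.integrableOn
    rw [hc₀, ← h2, h1]; ring
  have htailb : ∀ x : ℝ, 0 ≤ x → ‖c₀ - B x‖ ≤
      C' * J * (1 + x) ^ d * Real.exp (-(b * x ^ p)) := by
    intro x hx
    rw [htail x hx]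
    refine (norm_integral_le_integral_norm _).trans ?_
    have h1 : ∫ t in Ioi x, ‖h t‖ ≤
        ∫ t in Ioi x, C' * (1 + x) ^ d * Real.exp (-(b * x ^ p)) * w t := by
      refine setIntegral_mono_on hhint.norm.integrableOn (hint.const_mul _).integrableOn
        measurableSet_Ioi fun t ht => hhw x t hx ?_
      exact (le_of_lt ht).trans (le_abs_self t)
    refine h1.trans ?_
    rw [integral_const_mul]
    have h2 : ∫ t in Ioi x, w t ≤ J :=
      setIntegral_le_integral hint (Eventually.of_forall hw0)
    calc _ ≤ C' * (1 + x) ^ d * Real.exp (-(b * x ^ p)) * J := by gcongr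
      _ = _ := by ring
  have hgrB : ∀ z : ℂ, ‖B z‖ ≤ C * (1 + ‖z‖) ^ (N + 1) * Real.exp (b * |z.im| ^ p) := by
    intro z
    have h1 := primitive_norm_le (C := C * (1 + ‖z‖) ^ N * Real.exp (b * |z.im| ^ p)) hB0 hB
      (z := z) (fun w hw1 hw2 => by
        refine (hgr w).trans ?_
        have := hw2.trans (abs_im_le_norm z)
        gcongr)
    refine h1.trans ?_
    rw [pow_succ (1 + ‖z‖)]
    calc _ ≤ C * (1 + ‖z‖) ^ N * Real.exp (b * |z.im| ^ p) * (1 + ‖z‖) := by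
          gcongr
          linarith
      _ = _ := by ring
  set M₀ := C' * J + ‖c₀‖ + C with hM₀
  have hM₀0 : 0 ≤ M₀ := by positivity
  have hCJ : 0 ≤ C' * J := by positivity
  set K := N + d + 1 with hK
  have hgrG : ∀ z : ℂ, ‖c₀ - B z‖ ≤ M₀ * (1 + ‖z‖) ^ K * Real.exp (b * |z.im| ^ p) := by
    intro z
    have h1 : (1 : ℝ) ≤ 1 + ‖z‖ := by linarith [norm_nonneg z]
    have h2 : ‖c₀‖ ≤ ‖c₀‖ * (1 + ‖z‖) ^ K * Real.exp (b * |z.im| ^ p) := by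
      rw [mul_assoc]
      refine le_mul_of_one_le_right (norm_nonneg _) ?_
      exact one_le_mul_of_one_le_of_one_le (one_le_pow₀ h1) (Real.one_le_exp (by positivity))
    have h3 : ‖B z‖ ≤ C * (1 + ‖z‖) ^ K * Real.exp (b * |z.im| ^ p) := by
      refine (hgrB z).trans ?_
      gcongr
      omega
    have h4 : 0 ≤ C' * J * (1 + ‖z‖) ^ K * Real.exp (b * |z.im| ^ p) := by positivity
    have := norm_sub_le c₀ (B z)
    rw [hM₀, add_mul, add_mul, add_mul, add_mul]
    linarith
  set φ := p * (Real.pi / 4) with hφ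
  have hφ1 : 0 < φ := by positivity
  have hφ2 : φ < Real.pi / 2 := by nlinarith [Real.pi_pos]
  have hs : 0 < Real.sin φ := Real.sin_pos_of_pos_of_lt_pi hφ1 (by linarith)
  have hGd : Differentiable ℂ fun z => c₀ - B z :=
    (differentiable_const c₀).sub fun z => (hB z).differentiableAt
  have hray : ∀ ρ : ℝ, ‖c₀ - B (cexp (ρ + (Real.pi / 4 : ℝ) * I))‖ ≤
      M₀ * 2 ^ K * (1 + Real.exp ρ) ^ K := by
    intro ρ
    have h2φ : p * (Real.pi / 2) = 2 * φ := by rw [hφ]; ring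
    -- With `φ = pπ/4`, this `E` makes `E sin 2φ - b cos 2φ = b` at angle `π/2`, and `E sin φ - b
    -- cos φ = 0` at angle `π/4`.
    have := sector_bound (p := p) (b := b) (E := b * Real.cos φ / Real.sin φ) (B := b)
      (θ₀ := Real.pi / 2) (M := M₀) (N := K) hGd (by positivity) le_rfl hp0.le
      (by rw [h2φ]; linarith) hM₀0 hb.le
      (fun ρ => by
        have := htailb (Real.exp ρ) (Real.exp_pos ρ).le
        rw [exp_mul_eq_rpow, ← ofReal_exp]
        refine this.trans ?_
        have h1 : (1 : ℝ) ≤ 1 + Real.exp ρ := by linarith [Real.exp_pos ρ]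
        gcongr
        · rw [hM₀]; linarith [norm_nonneg c₀]
        · omega)
      (fun ρ => by
        have h1 := hgrG (cexp (ρ + (Real.pi / 2 : ℝ) * I))
        rw [norm_cexp_polar] at h1
        refine h1.trans (le_of_eq ?_)
        congr 2
        have h2 : |(cexp (ρ + (Real.pi / 2 : ℝ) * I)).im| = Real.exp ρ := by
          simp [Complex.exp_im]
        rw [h2, ← exp_mul_eq_rpow, h2φ, Real.sin_two_mul, Real.cos_two_mul]
        field_simp
        ring)
      (fun ρ θ _ _ => by
        have h1 := hgrG (cexp (ρ + θ * I))
        have h2 : |(cexp (ρ + θ * I)).im| ≤ Real.exp ρ := by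
          rw [← norm_cexp_polar ρ θ]; exact abs_im_le_norm _
        rw [norm_cexp_polar] at h1
        refine h1.trans ?_
        rw [exp_mul_eq_rpow p ρ]
        gcongr)
      (ρ := ρ) (θ := Real.pi / 4) (by positivity) (by linarith [Real.pi_pos])
    refine this.trans_eq ?_
    rw [← hφ, div_mul_cancel₀ _ hs.ne']
    simp
  have h2K : (1 : ℝ) ≤ 2 ^ K := one_le_pow₀ (by norm_num)
  refine ⟨M₀ * 2 ^ K + ‖c₀‖ + C' * C' * J, by positivity, fun x hx => ?_, fun z => ?_,
    fun z h0 h1 => ?_⟩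
  · have h1 := htailb x hx
    have h2 := hC' x hx
    have h3 : C' * J * (1 + x) ^ d * Real.exp (-(b * x ^ p)) ≤ C' * J * C' := by
      rw [mul_assoc]; gcongr
    have h4 : ‖B x‖ ≤ ‖c₀‖ + ‖c₀ - B x‖ := by
      have := norm_sub_le c₀ (c₀ - B x)
      simpa using this
    have : 0 ≤ M₀ * 2 ^ K := by positivity
    linarith
  · refine (hgrB z).trans ?_
    have h1 : (1 : ℝ) ≤ 1 + ‖z‖ := by linarith [norm_nonneg z]
    have h2 : C ≤ M₀ * 2 ^ K + ‖c₀‖ + C' * C' * J := by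
      have : C ≤ M₀ := by rw [hM₀]; linarith [norm_nonneg c₀]
      have h3 : M₀ ≤ M₀ * 2 ^ K := le_mul_of_one_le_right hM₀0 h2K
      have : 0 ≤ C' * C' * J := by positivity
      linarith [norm_nonneg c₀]
    gcongr
    · omega
    · exact abs_im_le_norm z
  · rcases h0.eq_or_lt with h2 | h2
    · have : z = 0 := Complex.ext h2.symm (by rw [← h1, ← h2]; rfl)
      rw [this, hB0, norm_zero]; positivity
    have hn : ‖z‖ = √2 * z.re := by
      rw [Complex.norm_def, normSq_apply, ← h1, ← two_mul, Real.sqrt_mul (by norm_num),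
        Real.sqrt_mul_self h0]
    have hz0 : 0 < ‖z‖ := by rw [hn]; positivity
    have hz : z = cexp (Real.log ‖z‖ + (Real.pi / 4 : ℝ) * I) := by
      have h22 : √2 * √2 = 2 := Real.mul_self_sqrt (by norm_num)
      apply Complex.ext
      · simp only [Complex.exp_re, add_re, ofReal_re, re_ofReal_mul, I_re, mul_zero, add_zero,
          add_im, ofReal_im, im_ofReal_mul, I_im, mul_one, zero_add, Real.exp_log hz0,
          Real.cos_pi_div_four]
        rw [hn]; linear_combination (-z.re / 2) * h22
      · simp only [Complex.exp_im, add_re, ofReal_re, re_ofReal_mul, I_re, mul_zero, add_zero,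
          add_im, ofReal_im, im_ofReal_mul, I_im, mul_one, zero_add, Real.exp_log hz0,
          Real.sin_pi_div_four]
        rw [hn, ← h1]; linear_combination (-z.re / 2) * h22
    have h3 := hray (Real.log ‖z‖)
    rw [← hz, Real.exp_log hz0] at h3
    have h4 : ‖B z‖ ≤ ‖c₀‖ + ‖c₀ - B z‖ := by
      have := norm_sub_le c₀ (c₀ - B z)
      simpa using this
    have h5 : ‖c₀‖ ≤ ‖c₀‖ * (1 + ‖z‖) ^ K :=
      le_mul_of_one_le_right (norm_nonneg _) (one_le_pow₀ (by linarith))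
    have h6 : 0 ≤ C' * C' * J * (1 + ‖z‖) ^ K := by positivity
    rw [add_mul, add_mul]
    linarith

/-- A Morgan-type uniqueness theorem on the line. -/
theorem morgan_line {p b C : ℝ} {N d : ℕ} {h : ℂ → ℂ} (hh : Differentiable ℂ h)
    (hp1 : 1 < p) (hp : p < 2) (hb : 0 < b)
    (hgr : ∀ z, ‖h z‖ ≤ C * (1 + |z.im|) ^ N * Real.exp (b * |z.im| ^ p))
    (hint : Integrable fun x : ℝ => ‖h x‖ / (1 + |x|) ^ d * Real.exp (b * |x| ^ p)) (z : ℂ) :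
    h z = 0 := by
  obtain ⟨B, hB0, hB⟩ := exists_primitive hh
  have hnegd : ∀ {h : ℂ → ℂ}, Differentiable ℂ h → Differentiable ℂ fun z => h (-z) :=
    fun hh => hh.comp differentiable_neg
  have hnegB : ∀ {h B : ℂ → ℂ}, (∀ z, HasDerivAt B (h z) z) →
      ∀ z, HasDerivAt (fun z => -B (-z)) (h (-z)) z := by
    intro h B hB z
    have := ((hB (-z)).comp z (hasDerivAt_neg z)).neg
    simpa using! this
  have hintneg : Integrable fun x : ℝ => ‖h (-x : ℝ)‖ / (1 + |x|) ^ d * Real.exp (b * |x| ^ p) := by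
    simpa using hint.comp_neg
  obtain ⟨M₁, hM₁, hx₁, hg₁, h₁⟩ := primitive_diagonal_bound hh hp1 hp hb hgr hint hB0 hB
  obtain ⟨M₂, hM₂, -, -, h₂⟩ := primitive_diagonal_bound (hnegd hh) hp1 hp hb
    (fun z => by simpa using hgr (-z)) (by simpa using hintneg) (by simpa using hB0) (hnegB hB)
  -- The symmetries `z ↦ -z` and `z ↦ conj z` preserve the hypotheses on `h` and carry the other
  -- three diagonal rays to the first.
  have hcd : Differentiable ℂ fun z => (starRingEnd ℂ) (h ((starRingEnd ℂ) z)) :=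
    fun w => differentiableAt_conj_conj_iff.2 (hh _)
  have hcB : ∀ z, HasDerivAt (fun z => (starRingEnd ℂ) (B ((starRingEnd ℂ) z)))
      ((starRingEnd ℂ) (h ((starRingEnd ℂ) z))) z := by
    intro z
    have := (hB ((starRingEnd ℂ) z)).conj_conj
    rw [Complex.conj_conj] at this
    exact this
  obtain ⟨M₃, hM₃, -, -, h₃⟩ := primitive_diagonal_bound hcd hp1 hp hb
    (fun z => by simpa using hgr ((starRingEnd ℂ) z)) (by simpa using hint) (by simpa using hB0) hcB
  obtain ⟨M₄, hM₄, -, -, h₄⟩ := primitive_diagonal_bound (hnegd hcd) hp1 hp hb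
    (fun z => by simpa using hgr (-(starRingEnd ℂ) z)) (by simpa using hintneg)
    (by simpa using hB0) (hnegB hcB)
  have hBd : Differentiable ℂ B := fun z => (hB z).differentiableAt
  set K := N + d + 1
  have hdiag : ∀ z : ℂ, |z.re| = |z.im| → ‖B z‖ ≤ (M₁ + M₂ + M₃ + M₄) * (1 + ‖z‖) ^ K := by
    intro z hz
    have hq : 0 ≤ (1 + ‖z‖) ^ K := by positivity
    have q₁ := mul_nonneg hM₁ hq
    have q₂ := mul_nonneg hM₂ hq
    have q₃ := mul_nonneg hM₃ hq
    have q₄ := mul_nonneg hM₄ hq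
    rw [add_mul, add_mul, add_mul]
    rcases abs_eq_abs.1 hz with hz | hz <;> rcases le_total 0 z.re with h0 | h0
    · have := h₁ z h0 hz
      linarith
    · have := h₂ (-z) (by simpa using h0) (by simpa using hz)
      simp only [neg_neg, norm_neg] at this
      linarith
    · have := h₃ ((starRingEnd ℂ) z) (by simpa using h0) (by simpa using hz)
      simp only [Complex.conj_conj, RCLike.norm_conj] at this
      linarith
    · have := h₄ (-(starRingEnd ℂ) z) (by simpa using h0) (by simp [hz])
      simp only [neg_neg, Complex.conj_conj, RCLike.norm_conj, norm_neg] at this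
      linarith
  have hgrow := growth_of_diagonals (M := M₁ + M₂ + M₃ + M₄) hBd (by linarith) hp hb.le
    (fun z => (hg₁ z).trans (by gcongr; linarith)) hdiag
  have := deriv_eq_zero_of_growth_of_bounded hBd hgrow hx₁ z
  rwa [(hB z).deriv] at this

/-! ### Fourier inversion almost everywhere. -/

section Inversion

variable {V : Type*} [NormedAddCommGroup V] [InnerProductSpace ℝ V] [MeasurableSpace V]
  [BorelSpace V] [FiniteDimensional ℝ V]

theorem integral_fourier_mul_eq_flip {f g : V → ℂ} (hf : Integrable f) (hg : Integrable g) :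
    ∫ ξ, 𝓕 f ξ * g ξ = ∫ x, f x * 𝓕 g x := by
  simpa using! (VectorFourier.integral_fourierIntegral_smul_eq_flip (L := innerₗ V)
    (μ := volume) (ν := volume) Real.continuous_fourierChar continuous_inner hf hg)

theorem continuous_fourier {f : V → ℂ} (hf : Integrable f) : Continuous (𝓕 f) :=
  VectorFourier.fourierIntegral_continuous (L := innerₗ V) Real.continuous_fourierChar
    continuous_inner hf

/-- Fourier inversion almost everywhere, for an integrable function with integrable transform. -/
theorem ae_eq_fourierInv_fourier {u : V → ℂ} (hu : Integrable u) (hFu : Integrable (𝓕 u)) :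
    ∀ᵐ x, u x = 𝓕 (𝓕 u) (-x) := by
  have hcont : Continuous fun x => 𝓕 (𝓕 u) (-x) := (continuous_fourier hFu).comp continuous_neg
  have hloc : LocallyIntegrable (fun x => u x - 𝓕 (𝓕 u) (-x)) volume :=
    hu.locallyIntegrable.sub hcont.locallyIntegrable
  -- Tested against a smooth compactly supported `φ`, the identity moves onto `φ` by the
  -- self-duality of 𝓕, where Schwartz inversion applies.
  have := ae_eq_zero_of_integral_contDiff_smul_eq_zero hloc (fun φ hφ hφc => ?_)
  · exact this.mono fun x hx => sub_eq_zero.1 hx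
  have hφ' : ContDiff ℝ (⊤ : ℕ∞) fun x => (φ x : ℂ) := ofRealCLM.contDiff.comp hφ
  have hφc' : HasCompactSupport fun x => (φ x : ℂ) := hφc.comp_left ofReal_zero
  set ψ : SchwartzMap V ℂ := hφc'.toSchwartzMap hφ' with hψ
  have hψφ : ∀ x, ψ x = (φ x : ℂ) := fun x => rfl
  have hψi : Integrable (ψ : V → ℂ) := ψ.integrable
  have hsmul : ∀ x, φ x • (u x - 𝓕 (𝓕 u) (-x)) = ψ x * u x - ψ x * 𝓕 (𝓕 u) (-x) := by
    intro x; rw [hψφ, ← mul_sub]; rfl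
  simp_rw [hsmul]
  have hi1 : Integrable fun x => ψ x * u x := by
    exact hu.bdd_mul (c := ‖ψ.toBoundedContinuousFunction‖) ψ.continuous.aestronglyMeasurable
      (Eventually.of_forall ψ.toBoundedContinuousFunction.norm_coe_le_norm)
  have hi2 : Integrable fun x => ψ x * 𝓕 (𝓕 u) (-x) :=
    (ψ.continuous.mul hcont).integrable_of_hasCompactSupport hφc'.mul_right
  rw [integral_sub hi1 hi2, sub_eq_zero]
  symm
  calc ∫ x, ψ x * 𝓕 (𝓕 u) (-x) = ∫ x, ψ (-x) * 𝓕 (𝓕 u) x := by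
        rw [← integral_neg_eq_self]; simp
    _ = ∫ ξ, 𝓕 (fun x => ψ (-x)) ξ * 𝓕 u ξ := (integral_fourier_mul_eq_flip hψi.comp_neg hFu).symm
    _ = ∫ ξ, (𝓕⁻ ψ : SchwartzMap V ℂ) ξ * 𝓕 u ξ := by
        congr 1
        ext ξ
        rw [SchwartzMap.fourierInv_coe, Real.fourierInv_eq_fourier_comp_neg]
    _ = ∫ x, 𝓕 (⇑(𝓕⁻ ψ : SchwartzMap V ℂ)) x * u x :=
        (integral_fourier_mul_eq_flip (𝓕⁻ ψ : SchwartzMap V ℂ).integrable hu).symm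
    _ = ∫ x, ψ x * u x := by
        rw [← SchwartzMap.fourier_coe, fourier_fourierInv_eq]

end Inversion

/-! ### Young's inequality and the Fourier transform on complexified lines. -/

/-- The factor `(1 + r)^d` must be absorbed without weakening either exponential constant. When `r
t` is at most half of `β^q r^q / q`, the other half absorbs it. Otherwise `r` is at most a power of
`1 + t`, so the factor becomes polynomial in `t` and Young's inequality applies with its exact
constants. -/
theorem exists_young_bound {p q β : ℝ} (hpq : p.HolderConjugate q) (hβ : 0 < β) (d : ℕ) :
    ∃ (N : ℕ) (C : ℝ), 0 ≤ C ∧ ∀ r t : ℝ, 0 ≤ r → 0 ≤ t →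
      (1 + r) ^ d * Real.exp (2 * Real.pi * (r * t)) ≤
        C * (1 + t) ^ N * Real.exp (2 * Real.pi / (p * β ^ p) * t ^ p) *
          Real.exp (2 * Real.pi * (β ^ q / q) * r ^ q) := by
  have hp := hpq.lt
  have hq := hpq.symm.lt
  have hq0 : 0 < q := by linarith
  have hp0 : 0 < p := by linarith
  have hβq : 0 < β ^ q := Real.rpow_pos_of_pos hβ _
  have hβp : 0 < β ^ p := Real.rpow_pos_of_pos hβ _
  set κ := β ^ q / (2 * q) with hκ
  have hκ0 : 0 < κ := by positivity
  obtain ⟨C₁, hC₁0, hC₁⟩ := one_add_pow_mul_exp_le d (c := 2 * Real.pi * κ) (p := q)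
    (by positivity) hq.le
  -- In the second regime `r ≤ (t / κ)^(p - 1)`; any natural exponent at least `p - 1` will do.
  set n := ⌈p⌉₊ with hn
  set κ' := (1 / κ) ^ (p - 1) with hκ'
  have hκ'0 : 0 < κ' := by positivity
  refine ⟨n * d, C₁ + (1 + κ') ^ d, by positivity, fun r t hr ht => ?_⟩
  have h1t : 1 ≤ (1 + t) ^ (n * d) := one_le_pow₀ (by linarith)
  have heqq : β ^ q / q = 2 * κ := by rw [hκ]; field_simp
  rcases le_or_gt (r * t) (κ * r ^ q) with h | h
  · have h1 : (1 + r) ^ d * Real.exp (2 * Real.pi * (r * t)) ≤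
        C₁ * Real.exp (2 * Real.pi * (β ^ q / q) * r ^ q) := by
      calc _ ≤ (1 + r) ^ d * Real.exp (2 * Real.pi * (κ * r ^ q)) := by gcongr
        _ = (1 + r) ^ d * Real.exp (-(2 * Real.pi * κ * r ^ q)) *
            Real.exp (2 * Real.pi * (β ^ q / q) * r ^ q) := by
              rw [mul_assoc ((1 + r) ^ d), ← Real.exp_add, heqq]; congr 2; ring
        _ ≤ _ := by gcongr; exact hC₁ r hr
    refine h1.trans ?_
    gcongr
    have h2 : 1 ≤ Real.exp (2 * Real.pi / (p * β ^ p) * t ^ p) := Real.one_le_exp (by positivity)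
    have h3 : C₁ ≤ C₁ + (1 + κ') ^ d := le_add_of_nonneg_right (by positivity)
    rw [mul_assoc]
    exact h3.trans (le_mul_of_one_le_right (by positivity)
      (one_le_mul_of_one_le_of_one_le h1t h2))
  · have hr0 : 0 < r := by
      rcases hr.eq_or_lt with h0 | h0
      · rw [← h0, Real.zero_rpow hq0.ne'] at h; simp at h
      · exact h0
    have h2 : r ^ (q - 1) ≤ t / κ := by
      rw [le_div_iff₀ hκ0]
      have h3 : r ^ q = r ^ (q - 1) * r := by
        rw [← Real.rpow_add_one hr0.ne', sub_add_cancel]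
      rw [h3] at h
      nlinarith
    have h4 : r ≤ κ' * (1 + t) ^ n := by
      have h5 : (r ^ (q - 1)) ^ (p - 1) = r := by
        rw [← Real.rpow_mul hr]
        have : (q - 1) * (p - 1) = 1 := by
          have := hpq.sub_one_mul_conj
          nlinarith
        rw [this, Real.rpow_one]
      rw [← h5]
      calc (r ^ (q - 1)) ^ (p - 1) ≤ (t / κ) ^ (p - 1) :=
            Real.rpow_le_rpow (by positivity) h2 (by linarith)
        _ = κ' * t ^ (p - 1) := by
            rw [hκ', ← Real.mul_rpow (by positivity) ht]; congr 1; ring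
        _ ≤ κ' * (1 + t) ^ (p - 1) := by
            gcongr; linarith
        _ ≤ κ' * (1 + t) ^ (n : ℝ) := by
            gcongr
            · linarith
            · have := Nat.le_ceil p; linarith
        _ = _ := by rw [Real.rpow_natCast]
    have h6 : (1 + r) ^ d ≤ (1 + κ') ^ d * (1 + t) ^ (n * d) := by
      rw [pow_mul, ← mul_pow]
      gcongr
      have : 1 ≤ (1 + t) ^ n := one_le_pow₀ (by linarith)
      linarith
    have h7 : r * t ≤ β ^ q / q * r ^ q + 1 / (p * β ^ p) * t ^ p := by
      have := Real.young_inequality_of_nonneg (a := t / β) (b := β * r) (by positivity)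
        (by positivity) hpq
      rw [Real.div_rpow ht hβ.le, Real.mul_rpow hβ.le hr] at this
      have h8 : t / β * (β * r) = r * t := by field_simp
      rw [h8] at this
      refine this.trans_eq ?_
      field_simp
      ring
    calc _ ≤ (1 + κ') ^ d * (1 + t) ^ (n * d) *
          Real.exp (2 * Real.pi * (β ^ q / q * r ^ q + 1 / (p * β ^ p) * t ^ p)) := by gcongr
      _ = (1 + κ') ^ d * (1 + t) ^ (n * d) *
          Real.exp (2 * Real.pi / (p * β ^ p) * t ^ p) *
          Real.exp (2 * Real.pi * (β ^ q / q) * r ^ q) := by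
            rw [mul_assoc _ (Real.exp _), ← Real.exp_add]; congr 2; ring
      _ ≤ _ := by
            gcongr
            linarith

section Slice

variable {V : Type*} [NormedAddCommGroup V] [InnerProductSpace ℝ V] [MeasurableSpace V]
  [BorelSpace V] [FiniteDimensional ℝ V]

/-- The Fourier transform of `v` along the complexified line through `x₀` in the direction `e`. -/
noncomputable def fourierSlice (v : V → ℂ) (x₀ e : V) (z : ℂ) : ℂ :=
  ∫ y, cexp (-(2 * Real.pi * I) * (inner ℝ y x₀ + z * inner ℝ y e)) * v y

theorem fourierSlice_ofReal (v : V → ℂ) (x₀ e : V) (s : ℝ) :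
    fourierSlice v x₀ e s = 𝓕 v (x₀ + s • e) := by
  rw [Real.fourier_eq', fourierSlice]
  congr 1
  ext y
  rw [smul_eq_mul, inner_add_right, inner_smul_right]
  congr 2
  push_cast
  ring

theorem norm_slice_kernel (a c : ℝ) (z : ℂ) :
    ‖cexp (-(2 * Real.pi * I) * (a + z * c))‖ = Real.exp (2 * Real.pi * (z.im * c)) := by
  rw [Complex.norm_exp]
  congr 1
  simp

variable {p q β : ℝ} {d : ℕ} {v : V → ℂ}

theorem integrable_exp_mul_of_weighted (hpq : p.HolderConjugate q) (hβ : 0 < β)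
    (hv : AEStronglyMeasurable v)
    (hint : Integrable fun y => ‖v y‖ / (1 + ‖y‖) ^ d *
      Real.exp (2 * Real.pi * (β ^ q / q) * ‖y‖ ^ q)) (m : ℕ) {t : ℝ} (ht : 0 ≤ t) :
    Integrable fun y => (1 + ‖y‖) ^ m * Real.exp (2 * Real.pi * (‖y‖ * t)) * ‖v y‖ := by
  obtain ⟨N, C, hC, h⟩ := exists_young_bound hpq hβ (d + m)
  refine (hint.const_mul (C * (1 + t) ^ N * Real.exp (2 * Real.pi / (p * β ^ p) * t ^ p))).mono'
    ((Continuous.aestronglyMeasurable (by fun_prop)).mul hv.norm) (Eventually.of_forall fun y => ?_)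
  rw [Real.norm_of_nonneg (by positivity)]
  have h1 := h ‖y‖ t (norm_nonneg y) ht
  rw [pow_add, mul_assoc] at h1
  have h2 : (1 + ‖y‖) ^ m * Real.exp (2 * Real.pi * (‖y‖ * t)) ≤
      (C * (1 + t) ^ N * Real.exp (2 * Real.pi / (p * β ^ p) * t ^ p) *
          Real.exp (2 * Real.pi * (β ^ q / q) * ‖y‖ ^ q)) / (1 + ‖y‖) ^ d := by
    rw [le_div_iff₀ (by positivity), mul_comm]; exact h1
  refine (mul_le_mul_of_nonneg_right h2 (norm_nonneg _)).trans_eq ?_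
  ring

theorem integrable_of_weighted (hpq : p.HolderConjugate q) (hβ : 0 < β)
    (hv : AEStronglyMeasurable v)
    (hint : Integrable fun y => ‖v y‖ / (1 + ‖y‖) ^ d *
      Real.exp (2 * Real.pi * (β ^ q / q) * ‖y‖ ^ q)) : Integrable v := by
  have := integrable_exp_mul_of_weighted hpq hβ hv hint 0 le_rfl
  rw [← integrable_norm_iff hv]
  simpa using this

/-- The kernel has modulus at most `exp(2π |y| |Im z|)`, which the sharp Young bound controls. The
order of quantifiers matters: `N` does not depend on `v`, and `C` does not depend on the line. -/
theorem norm_fourierSlice_le (V : Type*) [NormedAddCommGroup V] [InnerProductSpace ℝ V]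
    [MeasurableSpace V] [BorelSpace V] [FiniteDimensional ℝ V] {p q β : ℝ}
    (hpq : p.HolderConjugate q) (hβ : 0 < β) (d : ℕ) :
    ∃ N : ℕ, ∀ v : V → ℂ, (Integrable fun y => ‖v y‖ / (1 + ‖y‖) ^ d *
      Real.exp (2 * Real.pi * (β ^ q / q) * ‖y‖ ^ q)) →
    ∃ C : ℝ, ∀ (x₀ e : V), ‖e‖ ≤ 1 → ∀ z : ℂ, ‖fourierSlice v x₀ e z‖ ≤
      C * (1 + |z.im|) ^ N * Real.exp (2 * Real.pi / (p * β ^ p) * |z.im| ^ p) := by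
  obtain ⟨N, C, hC, h⟩ := exists_young_bound hpq hβ d
  refine ⟨N, fun v hint => ⟨C * ∫ y, ‖v y‖ / (1 + ‖y‖) ^ d *
      Real.exp (2 * Real.pi * (β ^ q / q) * ‖y‖ ^ q), fun x₀ e he z => ?_⟩⟩
  set T := (1 + |z.im|) ^ N * Real.exp (2 * Real.pi / (p * β ^ p) * |z.im| ^ p) with hT
  have hb : ∀ y, ‖cexp (-(2 * Real.pi * I) * (inner ℝ y x₀ + z * inner ℝ y e)) * v y‖ ≤
      C * T * (‖v y‖ / (1 + ‖y‖) ^ d * Real.exp (2 * Real.pi * (β ^ q / q) * ‖y‖ ^ q)) := by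
    intro y
    rw [norm_mul, norm_slice_kernel]
    have h1 := h ‖y‖ |z.im| (norm_nonneg y) (abs_nonneg _)
    have h2 : z.im * inner ℝ y e ≤ ‖y‖ * |z.im| := by
      refine (le_abs_self _).trans ?_
      rw [abs_mul, mul_comm]
      gcongr
      refine (abs_real_inner_le_norm _ _).trans ?_
      exact mul_le_of_le_one_right (norm_nonneg _) he
    calc _ ≤ Real.exp (2 * Real.pi * (‖y‖ * |z.im|)) * ‖v y‖ := by gcongr
      _ = (1 + ‖y‖) ^ d * Real.exp (2 * Real.pi * (‖y‖ * |z.im|)) *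
          (‖v y‖ / (1 + ‖y‖) ^ d) := by field_simp
      _ ≤ C * (1 + |z.im|) ^ N * Real.exp (2 * Real.pi / (p * β ^ p) * |z.im| ^ p) *
          Real.exp (2 * Real.pi * (β ^ q / q) * ‖y‖ ^ q) * (‖v y‖ / (1 + ‖y‖) ^ d) := by gcongr
      _ = _ := by rw [hT]; ring
  refine (norm_integral_le_of_norm_le (hint.const_mul (C * T)) (Eventually.of_forall hb)).trans_eq ?_
  rw [integral_const_mul, hT]
  ring

/-- Differentiation under the integral sign; the weight dominates the kernel on a unit disc around
`z₀`, together with the factor `|y|` produced by the derivative. -/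
theorem differentiable_fourierSlice (hpq : p.HolderConjugate q) (hβ : 0 < β)
    (hv : AEStronglyMeasurable v)
    (hint : Integrable fun y => ‖v y‖ / (1 + ‖y‖) ^ d *
      Real.exp (2 * Real.pi * (β ^ q / q) * ‖y‖ ^ q)) (x₀ : V) {e : V} (he : ‖e‖ ≤ 1) :
    Differentiable ℂ (fourierSlice v x₀ e) := by
  intro z₀
  have hmeas : ∀ z : ℂ, AEStronglyMeasurable fun y =>
      cexp (-(2 * Real.pi * I) * (inner ℝ y x₀ + z * inner ℝ y e)) * v y := fun z =>
    (Continuous.aestronglyMeasurable (by fun_prop)).mul hv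
  have hie : ∀ y, |inner ℝ y e| ≤ ‖y‖ := fun y =>
    (abs_real_inner_le_norm _ _).trans (mul_le_of_le_one_right (norm_nonneg _) he)
  have hker : ∀ (t : ℝ) (z : ℂ) (y : V), |z.im| ≤ t →
      ‖cexp (-(2 * Real.pi * I) * (inner ℝ y x₀ + z * inner ℝ y e))‖ ≤
        Real.exp (2 * Real.pi * (‖y‖ * t)) := by
    intro t z y ht
    rw [norm_slice_kernel]
    have h1 : z.im * inner ℝ y e ≤ ‖y‖ * t := by
      refine (le_abs_self _).trans ?_
      rw [abs_mul, mul_comm]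
      have := hie y
      gcongr
    gcongr
  refine (hasDerivAt_integral_of_dominated_loc_of_deriv_le (μ := volume)
    (F := fun z y => cexp (-(2 * Real.pi * I) * (inner ℝ y x₀ + z * inner ℝ y e)) * v y)
    (F' := fun z y => cexp (-(2 * Real.pi * I) * (inner ℝ y x₀ + z * inner ℝ y e)) *
      (-(2 * Real.pi * I) * inner ℝ y e) * v y)
    (bound := fun y => 2 * Real.pi * ((1 + ‖y‖) ^ 1 *
      Real.exp (2 * Real.pi * (‖y‖ * (|z₀.im| + 1))) * ‖v y‖))
    (Metric.ball_mem_nhds z₀ one_pos) (Eventually.of_forall hmeas) ?_ ?_ ?_ ?_ ?_).2.differentiableAt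
  · refine (integrable_exp_mul_of_weighted hpq hβ hv hint 0 (abs_nonneg z₀.im)).mono' (hmeas z₀)
      (Eventually.of_forall fun y => ?_)
    rw [norm_mul, pow_zero, one_mul]
    gcongr
    exact hker _ _ _ le_rfl
  · exact (Continuous.aestronglyMeasurable (by fun_prop)).mul hv
  · refine Eventually.of_forall fun y z hz => ?_
    have hz' : |z.im| ≤ |z₀.im| + 1 := by
      have h1 : |z.im - z₀.im| ≤ ‖z - z₀‖ := by
        rw [← sub_im]; exact abs_im_le_norm _
      have h2 : ‖z - z₀‖ < 1 := mem_ball_iff_norm.1 hz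
      have h3 := abs_sub_abs_le_abs_sub z.im z₀.im
      linarith
    rw [norm_mul, norm_mul, norm_mul]
    have h4 : ‖-(2 * (Real.pi : ℂ) * I)‖ = 2 * Real.pi := by
      simp [abs_of_pos Real.pi_pos]
    have h5 : ‖((inner ℝ y e : ℝ) : ℂ)‖ ≤ 1 + ‖y‖ := by
      rw [norm_real, Real.norm_eq_abs]
      linarith [hie y]
    rw [h4]
    calc _ ≤ Real.exp (2 * Real.pi * (‖y‖ * (|z₀.im| + 1))) * (2 * Real.pi * (1 + ‖y‖)) *
          ‖v y‖ := by
          gcongr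
          exact hker _ _ _ hz'
      _ = _ := by ring
  · exact (integrable_exp_mul_of_weighted hpq hβ hv hint 1 (by positivity)).const_mul _
  · refine Eventually.of_forall fun y z _ => ?_
    refine (HasDerivAt.cexp ?_).mul_const (v y)
    have h1 : HasDerivAt (fun z : ℂ => (inner ℝ y x₀ : ℂ) + z * (inner ℝ y e : ℂ))
        (inner ℝ y e : ℂ) z := by
      simpa using ((hasDerivAt_id z).mul_const (inner ℝ y e : ℂ)).const_add (inner ℝ y x₀ : ℂ)
    exact h1.const_mul _

end Slice

/-! ### Polar coordinates and the degree of quaternion polynomials. -/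

theorem measurePreserving_plane :
    MeasurePreserving (fun z : ℝ × ℝ => (!₂[z.1, z.2] : Plane)) := by
  exact (PiLp.volume_preserving_toLp (Fin 2)).comp (volume_preserving_finTwoArrow ℝ).symm

theorem continuous_plane : Continuous fun z : ℝ × ℝ => (!₂[z.1, z.2] : Plane) := by
  refine (PiLp.continuous_toLp 2 _).comp (continuous_pi fun i => ?_)
  fin_cases i
  · exact continuous_fst
  · exact continuous_snd

theorem integrable_comp_plane {E : Type*} [NormedAddCommGroup E] {g : Plane → E}
    (hg : Integrable g) : Integrable fun z : ℝ × ℝ => g !₂[z.1, z.2] :=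
  measurePreserving_plane.integrable_comp_of_integrable hg

theorem norm_plane_sq (a b : ℝ) : ‖(!₂[a, b] : Plane)‖ ^ 2 = a ^ 2 + b ^ 2 := by
  rw [EuclideanSpace.norm_sq_eq]
  simp

theorem QPoly.eval_polar (P : QPoly) (r θ : ℝ) :
    P.eval !₂[r * Real.cos θ, r * Real.sin θ] = ∑ s ∈ P.support,
      r ^ (s.1 + s.2) • ((Real.cos θ ^ s.1 * Real.sin θ ^ s.2) • P s) := by
  rw [QPoly.eval, Finsupp.sum]
  refine Finset.sum_congr rfl fun s _ => ?_
  rw [smul_smul]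
  congr 1
  simp only [Fin.isValue, Matrix.cons_val_zero, Matrix.cons_val_one]
  ring

theorem QPoly.continuous_eval (P : QPoly) : Continuous P.eval := by
  unfold QPoly.eval Finsupp.sum
  refine continuous_finsetSum _ fun s _ => ?_
  fun_prop

theorem ae_integrableOn_polar {g : Plane → ℝ} (hgc : Continuous g) (hg : Integrable g) :
    ∀ᵐ θ ∂(volume.restrict (Ioo (-Real.pi) Real.pi)),
      IntegrableOn (fun r : ℝ => r * g !₂[r * Real.cos θ, r * Real.sin θ]) (Ioi 0) := by
  have h1 := (integrable_comp_plane hg).2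
  rw [HasFiniteIntegral, ← lintegral_comp_polarCoord_symm, polarCoord_target,
    Measure.volume_eq_prod, ← Measure.prod_restrict] at h1
  have hc : Continuous fun z : ℝ × ℝ => z.1 * g !₂[z.1 * Real.cos z.2, z.1 * Real.sin z.2] :=
    continuous_fst.mul (hgc.comp (continuous_plane.comp
      (f := fun z : ℝ × ℝ => (z.1 * Real.cos z.2, z.1 * Real.sin z.2)) (by fun_prop)))
  have h2 : ∀ z : ℝ × ℝ, ‖z.1 * g !₂[z.1 * Real.cos z.2, z.1 * Real.sin z.2]‖ₑ = ‖z.1‖ₑ *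
      ‖g !₂[z.1 * Real.cos z.2, z.1 * Real.sin z.2]‖ₑ := fun z => enorm_mul _ _
  have h3 : Integrable (fun z : ℝ × ℝ => z.1 * g !₂[z.1 * Real.cos z.2, z.1 * Real.sin z.2])
      ((volume.restrict (Ioi 0)).prod (volume.restrict (Ioo (-Real.pi) Real.pi))) := by
    refine ⟨hc.aestronglyMeasurable, lt_of_le_of_lt (le_of_eq ?_) h1⟩
    rw [Measure.prod_restrict]
    refine setLIntegral_congr_fun (measurableSet_Ioi.prod measurableSet_Ioo) fun z hz => ?_
    simp only [h2, polarCoord_symm_apply, smul_eq_mul]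
    rw [Real.enorm_eq_ofReal (le_of_lt hz.1)]
  exact h3.prod_left_ae

/-- If `c ≠ 0`, the integrand is eventually at least a constant times `r^(m+1) / (1 + r)^d`, hence
at least a constant times `1/r` because `d ≤ m + 2`. -/
theorem not_integrableOn_of_tendsto {E : Type*} [NormedAddCommGroup E] [NormedSpace ℝ E]
    {F : ℝ → E} {c : E} {m d : ℕ} (hmd : d ≤ m + 2)
    (hF : Tendsto (fun r : ℝ => (r ^ m)⁻¹ • F r) atTop (𝓝 c))
    (hint : IntegrableOn (fun r : ℝ => r * (‖F r‖ / (1 + r) ^ d)) (Ioi 0)) : c = 0 := by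
  by_contra hc
  have hc0 : 0 < ‖c‖ := norm_pos_iff.2 hc
  have h1 : ∀ᶠ r : ℝ in atTop, ‖c‖ / 2 < ‖(r ^ m)⁻¹ • F r‖ :=
    hF.norm.eventually_const_lt (by linarith)
  obtain ⟨R, hR⟩ := eventually_atTop.1 (h1.and (eventually_ge_atTop 1))
  have hR1 : 1 ≤ R := (hR R le_rfl).2
  refine not_integrableOn_Ioi_inv (a := R) ?_
  refine ((hint.mono_set (Ioi_subset_Ioi (by linarith : (0 : ℝ) ≤ R))).const_mul
    (2 / ‖c‖ * 2 ^ d)).mono' ?_ ?_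
  · exact measurable_inv.aestronglyMeasurable
  refine (ae_restrict_iff' measurableSet_Ioi).2 (Eventually.of_forall fun r hr => ?_)
  obtain ⟨h2, h3⟩ := hR r (le_of_lt hr)
  have hr0 : 0 < r := by linarith
  rw [norm_smul, norm_inv, norm_pow, Real.norm_of_nonneg hr0.le, inv_mul_eq_div,
    lt_div_iff₀ (by positivity)] at h2
  rw [norm_inv, Real.norm_of_nonneg hr0.le]
  have h4 : (1 + r) ^ d ≤ 2 ^ d * r ^ (m + 2) := by
    calc (1 + r) ^ d ≤ (2 * r) ^ d := by
          have : 1 + r ≤ 2 * r := by linarith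
          gcongr
      _ = 2 ^ d * r ^ d := mul_pow _ _ _
      _ ≤ _ := by gcongr
  have h5 : r⁻¹ ≤ 2 ^ d * (r ^ (m + 1) / (1 + r) ^ d) := by
    rw [mul_div_assoc', le_div_iff₀ (by positivity), inv_mul_le_iff₀ hr0]
    calc _ ≤ _ := h4
      _ = _ := by ring
  refine h5.trans ?_
  have h6 : r ^ m ≤ 2 / ‖c‖ * ‖F r‖ := by
    rw [div_mul_eq_mul_div, le_div_iff₀ hc0]; linarith
  calc 2 ^ d * (r ^ (m + 1) / (1 + r) ^ d) = 2 ^ d * (r * (r ^ m / (1 + r) ^ d)) := by ring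
    _ ≤ 2 ^ d * (r * (2 / ‖c‖ * ‖F r‖ / (1 + r) ^ d)) := by gcongr
    _ = _ := by ring

theorem QPoly.tendsto_leading (P : QPoly) {m : ℕ} (hm : ∀ s ∈ P.support, s.1 + s.2 ≤ m) (θ : ℝ) :
    Tendsto (fun r : ℝ => (r ^ m)⁻¹ • P.eval !₂[r * Real.cos θ, r * Real.sin θ]) atTop
      (𝓝 (∑ s ∈ P.support with s.1 + s.2 = m, (Real.cos θ ^ s.1 * Real.sin θ ^ s.2) • P s)) := by
  simp_rw [QPoly.eval_polar, Finset.smul_sum, Finset.sum_filter]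
  refine tendsto_finsetSum _ fun s hs => ?_
  split_ifs with h
  · refine tendsto_const_nhds.congr' ?_
    filter_upwards [eventually_gt_atTop 0] with r hr
    rw [h, smul_smul, inv_mul_cancel₀ (by positivity), one_smul]
  · have hlt : s.1 + s.2 < m := lt_of_le_of_ne (hm s hs) h
    have h1 : Tendsto (fun r : ℝ => (r ^ m)⁻¹ * r ^ (s.1 + s.2)) atTop (𝓝 0) := by
      have := tendsto_pow_neg_atTop (𝕜 := ℝ) (n := m - (s.1 + s.2)) (by omega)
      refine this.congr' ?_
      filter_upwards [eventually_gt_atTop 0] with r hr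
      have h2 : r ^ m = r ^ (s.1 + s.2) * r ^ (m - (s.1 + s.2)) := by
        rw [← pow_add, Nat.add_sub_cancel' hlt.le]
      rw [zpow_neg, zpow_natCast, h2]
      field_simp
    have h2 := h1.smul_const ((Real.cos θ ^ s.1 * Real.sin θ ^ s.2) • P s)
    rw [zero_smul] at h2
    simpa only [smul_smul, mul_assoc] using h2

/-- A quaternion polynomial whose quotient by `(1 + ‖x‖) ^ d` is integrable over the plane has
degree less than `d - 2`. -/
theorem QPoly.degree_lt_of_integrable (P : QPoly) {d : ℕ}
    (hint : Integrable fun x : Plane => ‖P.eval x‖ / (1 + ‖x‖) ^ d) :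
    P.degree + 2 < (d : WithBot ℕ) := by
  rcases P.support.eq_empty_or_nonempty with h0 | hne
  · rw [QPoly.degree, h0, Finset.sup_empty, WithBot.bot_add]
    exact WithBot.bot_lt_coe d
  obtain ⟨s₀, hs₀, hmax⟩ := P.support.exists_max_image (fun s => s.1 + s.2) hne
  set m := s₀.1 + s₀.2 with hm
  have hdeg : P.degree ≤ (m : WithBot ℕ) :=
    Finset.sup_le fun s hs => WithBot.coe_le_coe.2 (hmax s hs)
  suffices h : m + 2 < d by
    refine lt_of_le_of_lt (add_le_add_left hdeg 2) ?_
    exact_mod_cast h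
  by_contra hcon
  have hmd : d ≤ m + 2 := not_lt.1 hcon
  have hcont : Continuous fun x : Plane => ‖P.eval x‖ / (1 + ‖x‖) ^ d := by
    refine P.continuous_eval.norm.div (by fun_prop) fun x => by positivity
  set Q : ℝ → Quaternion ℝ := fun θ =>
    ∑ s ∈ P.support with s.1 + s.2 = m, (Real.cos θ ^ s.1 * Real.sin θ ^ s.2) • P s with hQ
  have hQc : Continuous Q := continuous_finsetSum _ fun s _ => by fun_prop
  -- On almost every ray the radial integral converges, which forces the leading form `Q` to vanish
  -- there; continuity then gives every angle.
  have hae : Q =ᵐ[volume.restrict (Ioo (-Real.pi) Real.pi)] fun _ => 0 := by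
    filter_upwards [ae_integrableOn_polar hcont hint] with θ hθ
    refine not_integrableOn_of_tendsto hmd (P.tendsto_leading hmax θ) ?_
    refine hθ.congr_fun (fun r hr => ?_) measurableSet_Ioi
    have h1 : ‖(!₂[r * Real.cos θ, r * Real.sin θ] : Plane)‖ = r := by
      rw [← Real.sqrt_sq (norm_nonneg _), norm_plane_sq]
      have : (r * Real.cos θ) ^ 2 + (r * Real.sin θ) ^ 2 = r ^ 2 := by
        linear_combination r ^ 2 * Real.sin_sq_add_cos_sq θ
      rw [this, Real.sqrt_sq (le_of_lt hr)]
    simp only [h1]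
  have hQ0 := Measure.eqOn_open_of_ae_eq hae isOpen_Ioo hQc.continuousOn continuousOn_const
  -- Dehomogenisation: at the angle `arctan t`, dividing by `cos^m` leaves a one-variable polynomial
  -- in `t`.
  have hpoly : ∀ t : ℝ, ∑ s ∈ P.support with s.1 + s.2 = m, t ^ s.2 • P s = 0 := by
    intro t
    have hc := Real.cos_arctan_pos t
    have h1 : Q (Real.arctan t) = 0 := hQ0 ⟨by
      linarith [Real.neg_pi_div_two_lt_arctan t, Real.pi_pos], by
      linarith [Real.arctan_lt_pi_div_two t, Real.pi_pos]⟩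
    have h2 : Q (Real.arctan t) = Real.cos (Real.arctan t) ^ m •
        ∑ s ∈ P.support with s.1 + s.2 = m, t ^ s.2 • P s := by
      rw [hQ, Finset.smul_sum]
      refine Finset.sum_congr rfl fun s hs => ?_
      have hsin : Real.sin (Real.arctan t) = t * Real.cos (Real.arctan t) := by
        rw [← Real.tan_mul_cos hc.ne', Real.tan_arctan]
      rw [smul_smul, hsin, ← (Finset.mem_filter.1 hs).2]
      congr 1
      ring
    rw [h2] at h1
    exact (smul_eq_zero.1 h1).resolve_left (by positivity)
  -- Pairing with the coefficient `P s₀` gives a real polynomial that vanishes identically, and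
  -- whose coefficient at `s₀.2` is `‖P s₀‖²`.
  set R : Polynomial ℝ := ∑ s ∈ P.support with s.1 + s.2 = m,
    Polynomial.monomial s.2 (inner ℝ (P s₀) (P s)) with hR
  have hR0 : R = 0 := by
    refine Polynomial.funext fun t => ?_
    have := congrArg (fun w => inner ℝ (P s₀) w) (hpoly t)
    simp only [inner_sum, inner_smul_right, inner_zero_right] at this
    rw [hR, Polynomial.eval_finsetSum, Polynomial.eval_zero, ← this]
    refine Finset.sum_congr rfl fun s _ => ?_
    rw [Polynomial.eval_monomial, mul_comm]
  have hcoef : R.coeff s₀.2 = inner ℝ (P s₀) (P s₀) := by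
    rw [hR, Polynomial.finsetSum_coeff, Finset.sum_eq_single s₀]
    · rw [Polynomial.coeff_monomial, if_pos rfl]
    · intro s hs hne
      rw [Polynomial.coeff_monomial, if_neg]
      intro h2
      have h1 := (Finset.mem_filter.1 hs).2
      exact hne (Prod.ext (by omega) h2)
    · intro h; exact absurd (Finset.mem_filter.2 ⟨hs₀, hm.symm⟩) h
  rw [hR0, Polynomial.coeff_zero, eq_comm, inner_self_eq_zero] at hcoef
  exact Finsupp.mem_support_iff.1 hs₀ hcoef

/-! ### From lines to the plane. -/

/-- The point of the plane with `i`-th coordinate `s` and other coordinate `t`. -/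
noncomputable def coordPoint (i : Fin 2) (t s : ℝ) : Plane :=
  EuclideanSpace.single (1 - i) t + s • EuclideanSpace.single i (1 : ℝ)

theorem coordPoint_zero (t s : ℝ) : coordPoint 0 t s = !₂[s, t] := by
  ext j; fin_cases j <;> simp [coordPoint]

theorem coordPoint_one (t s : ℝ) : coordPoint 1 t s = !₂[t, s] := by
  ext j; fin_cases j <;> simp [coordPoint]

theorem continuous_coordPoint_left (i : Fin 2) (s : ℝ) :
    Continuous fun t => coordPoint i t s := by
  fin_cases i
  · simp only [Fin.zero_eta, coordPoint_zero]
    exact continuous_plane.comp (f := fun t : ℝ => (s, t)) (by fun_prop)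
  · simp only [Fin.mk_one, coordPoint_one]
    exact continuous_plane.comp (f := fun t : ℝ => (t, s)) (by fun_prop)

theorem continuous_coordPoint_right (i : Fin 2) (t : ℝ) :
    Continuous fun s => coordPoint i t s := by
  unfold coordPoint
  fun_prop

theorem norm_coordPoint_sq (i : Fin 2) (t s : ℝ) : ‖coordPoint i t s‖ ^ 2 = s ^ 2 + t ^ 2 := by
  fin_cases i
  · simp only [Fin.zero_eta, coordPoint_zero, norm_plane_sq]
  · simp only [Fin.mk_one, coordPoint_one, norm_plane_sq, add_comm]

theorem abs_le_norm_coordPoint (i : Fin 2) (t s : ℝ) : |s| ≤ ‖coordPoint i t s‖ := by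
  refine abs_le_of_sq_le_sq ?_ (norm_nonneg _)
  rw [norm_coordPoint_sq]; nlinarith [sq_nonneg t]

theorem norm_coordPoint_le (i : Fin 2) (t s : ℝ) : ‖coordPoint i t s‖ ≤ |s| + |t| := by
  refine le_of_sq_le_sq ?_ (by positivity)
  rw [norm_coordPoint_sq, add_sq, sq_abs, sq_abs]
  have : 0 ≤ 2 * |s| * |t| := by positivity
  linarith

theorem ae_integrable_coordPoint {g : Plane → ℝ} (hg : Integrable g) (i : Fin 2) :
    ∀ᵐ t : ℝ, Integrable fun s => g (coordPoint i t s) := by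
  have h := integrable_comp_plane hg
  fin_cases i
  · simp only [Fin.zero_eta, coordPoint_zero]
    exact h.prod_left_ae
  · simp only [Fin.mk_one, coordPoint_one]
    exact h.prod_right_ae

/-- Fubini, combined with `|s| ≤ ‖x‖` for the exponential and `1 + ‖x‖ ≤ (1 + |t|)(1 + |s|)` for the
denominator; the factor `(1 + |t|)^d` is constant on the slice. -/
theorem ae_integrable_weighted_slice {u : Plane → ℂ} (hu : Continuous u) {a p : ℝ} {d : ℕ}
    (ha : 0 ≤ a) (hp : 0 ≤ p)
    (hint : Integrable fun x => ‖u x‖ / (1 + ‖x‖) ^ d * Real.exp (a * ‖x‖ ^ p)) (i : Fin 2) :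
    ∀ᵐ t : ℝ, Integrable fun s : ℝ =>
      ‖u (coordPoint i t s)‖ / (1 + |s|) ^ d * Real.exp (a * |s| ^ p) := by
  filter_upwards [ae_integrable_coordPoint hint i] with t ht
  refine (ht.const_mul ((1 + |t|) ^ d)).mono' ?_ (Eventually.of_forall fun s => ?_)
  · refine AEStronglyMeasurable.mul ?_ (Measurable.aestronglyMeasurable (by fun_prop))
    refine Continuous.aestronglyMeasurable ?_
    exact ((hu.comp (continuous_coordPoint_right i t)).norm).div (by fun_prop)
      fun s => by positivity
  · rw [Real.norm_of_nonneg (by positivity)]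
    have h1 := abs_le_norm_coordPoint i t s
    have h2 : 1 + ‖coordPoint i t s‖ ≤ (1 + |t|) * (1 + |s|) := by
      have := norm_coordPoint_le i t s
      nlinarith [abs_nonneg s, abs_nonneg t]
    have h3 : ‖u (coordPoint i t s)‖ / (1 + |s|) ^ d ≤
        (1 + |t|) ^ d * (‖u (coordPoint i t s)‖ / (1 + ‖coordPoint i t s‖) ^ d) := by
      rw [mul_div_assoc', div_le_div_iff₀ (by positivity) (by positivity)]
      calc _ ≤ ‖u (coordPoint i t s)‖ * ((1 + |t|) * (1 + |s|)) ^ d := by gcongr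
        _ = _ := by rw [mul_pow]; ring
    rw [← mul_assoc]
    gcongr

section Planar

variable {v : Plane → ℂ}

theorem fourierSlice_coordPoint (v : Plane → ℂ) (i : Fin 2) (t s : ℝ) :
    fourierSlice v (EuclideanSpace.single (1 - i) t) (EuclideanSpace.single i 1) s =
      𝓕 v (coordPoint i t s) := fourierSlice_ofReal _ _ _ _

theorem norm_single_one_le (i : Fin 2) : ‖(EuclideanSpace.single i (1 : ℝ) : Plane)‖ ≤ 1 := by
  simp

theorem eq_of_ae_coordPoint {u w : Plane → ℂ} (hu : Continuous u) (hw : Continuous w) (i : Fin 2)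
    (h : ∀ᵐ t : ℝ, ∀ s : ℝ, u (coordPoint i t s) = w (coordPoint i t s)) (t s : ℝ) :
    u (coordPoint i t s) = w (coordPoint i t s) := by
  have h1 := ((hu.comp (continuous_coordPoint_left i s)).ae_eq_iff_eq volume
    (hw.comp (continuous_coordPoint_left i s))).1 (h.mono fun t ht => ht s)
  exact congrFun h1 t

theorem eq_zero_of_ae_coordPoint {u : Plane → ℂ} (hu : Continuous u)
    (h : ∀ᵐ t : ℝ, ∀ s : ℝ, u (coordPoint 0 t s) = 0) : u = 0 := by
  ext x
  have h1 := eq_of_ae_coordPoint hu continuous_const (w := fun _ => 0) 0 h (x 1) (x 0)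
  have h2 : coordPoint 0 (x 1) (x 0) = x := by
    rw [coordPoint_zero]; ext j; fin_cases j <;> simp
  rwa [h2] at h1

theorem mono_weight {u : Plane → ℂ} (hu : Continuous u) {a b p : ℝ} {d : ℕ} (hab : b ≤ a)
    (hint : Integrable fun x => ‖u x‖ / (1 + ‖x‖) ^ d * Real.exp (a * ‖x‖ ^ p)) :
    Integrable fun x => ‖u x‖ / (1 + ‖x‖) ^ d * Real.exp (b * ‖x‖ ^ p) := by
  refine hint.mono' ?_ (Eventually.of_forall fun x => ?_)
  · refine AEStronglyMeasurable.mul ?_ (Measurable.aestronglyMeasurable (by fun_prop))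
    exact (hu.norm.div (by fun_prop) fun s => by positivity).aestronglyMeasurable
  · rw [Real.norm_of_nonneg (by positivity)]
    gcongr

/-- Morgan-type uniqueness in the plane. -/
theorem fourier_eq_zero_of_morgan {p q a β : ℝ} {d : ℕ} (hpq : p.HolderConjugate q) (hp : p < 2)
    (hβ : 0 < β) (hv : AEStronglyMeasurable v)
    (hint : Integrable fun y => ‖v y‖ / (1 + ‖y‖) ^ d *
      Real.exp (2 * Real.pi * (β ^ q / q) * ‖y‖ ^ q))
    (hint' : Integrable fun x => ‖𝓕 v x‖ / (1 + ‖x‖) ^ d * Real.exp (a * ‖x‖ ^ p))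
    (hab : 2 * Real.pi / (p * β ^ p) ≤ a) : 𝓕 v = 0 := by
  have hp1 := hpq.lt
  have hc := continuous_fourier (integrable_of_weighted hpq hβ hv hint)
  have hβp := Real.rpow_pos_of_pos hβ p
  have hb0 : 0 < 2 * Real.pi / (p * β ^ p) := by
    have : 0 < p := by linarith
    positivity
  obtain ⟨N, hN⟩ := norm_fourierSlice_le Plane hpq hβ d
  obtain ⟨C, hC⟩ := hN v hint
  refine eq_zero_of_ae_coordPoint hc ?_
  filter_upwards [ae_integrable_weighted_slice hc hb0.le (by linarith) (mono_weight hc hab hint') 0]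
    with t ht s
  rw [← fourierSlice_coordPoint]
  refine morgan_line (N := N) (d := d) (differentiable_fourierSlice hpq hβ hv hint _
    (norm_single_one_le 0)) hp1 hp hb0 (hC _ _ (norm_single_one_le 0)) ?_ _
  simpa only [fourierSlice_coordPoint] using ht

/-- Hardy-type uniqueness in the plane, above the critical constant. -/
theorem fourier_eq_zero_of_hardy {a β : ℝ} {d : ℕ}
    (hβ : 0 < β) (hv : AEStronglyMeasurable v)
    (hint : Integrable fun y => ‖v y‖ / (1 + ‖y‖) ^ d *
      Real.exp (2 * Real.pi * (β ^ (2 : ℝ) / 2) * ‖y‖ ^ (2 : ℝ)))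
    (hint' : Integrable fun x => ‖𝓕 v x‖ / (1 + ‖x‖) ^ d * Real.exp (a * ‖x‖ ^ (2 : ℝ)))
    (hab : 2 * Real.pi / (2 * β ^ (2 : ℝ)) < a) : 𝓕 v = 0 := by
  have hpq : (2 : ℝ).HolderConjugate 2 := Real.HolderConjugate.two_two
  have hc := continuous_fourier (integrable_of_weighted hpq hβ hv hint)
  have hb0 : 0 < 2 * Real.pi / (2 * β ^ (2 : ℝ)) := by positivity
  set b := 2 * Real.pi / (2 * β ^ (2 : ℝ)) with hb
  obtain ⟨N, hN⟩ := norm_fourierSlice_le Plane hpq hβ d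
  obtain ⟨C, hC⟩ := hN v hint
  -- The surplus `a - b > 0` absorbs `(1 + |x|)^d`, leaving the critical weight with no denominator.
  obtain ⟨K, hK0, hK⟩ := one_add_pow_mul_exp_le d (sub_pos.2 hab) (one_le_two)
  refine eq_zero_of_ae_coordPoint hc ?_
  filter_upwards [ae_integrable_weighted_slice hc (hb0.trans hab).le (by norm_num) hint' 0]
    with t ht s
  rw [← fourierSlice_coordPoint]
  have hd := differentiable_fourierSlice hpq hβ hv hint (EuclideanSpace.single (1 - 0) t)
    (norm_single_one_le 0)
  refine gaussian_line_eq_zero (N := N) (b := b) (C := C) hd hb0.le (fun z => ?_) ?_ _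
  · have := hC (EuclideanSpace.single (1 - 0) t) _ (norm_single_one_le 0) z
    rwa [Real.rpow_two |z.im|, sq_abs] at this
  · refine (ht.const_mul K).mono' ?_ (Eventually.of_forall fun x => ?_)
    · refine Continuous.aestronglyMeasurable ?_
      exact (hd.continuous.comp continuous_ofReal).norm.mul (by fun_prop)
    · rw [Real.norm_of_nonneg (by positivity), fourierSlice_coordPoint]
      have h1 := hK |x| (abs_nonneg x)
      have h2 : Real.exp (b * x ^ 2) =
          Real.exp (-((a - b) * |x| ^ (2 : ℝ))) * Real.exp (a * |x| ^ (2 : ℝ)) := by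
        rw [← Real.exp_add, Real.rpow_two, sq_abs]
        congr 1; ring
      rw [h2]
      calc _ = (1 + |x|) ^ d * Real.exp (-((a - b) * |x| ^ (2 : ℝ))) *
            (‖𝓕 v (coordPoint 0 t x)‖ / (1 + |x|) ^ d * Real.exp (a * |x| ^ (2 : ℝ))) := by
              field_simp
        _ ≤ _ := by gcongr

/-- The Lagrange basis polynomials with nodes `0, …, n`. -/
noncomputable def nodeBasis (n k : ℕ) : Polynomial ℝ :=
  Lagrange.basis (Finset.range (n + 1)) (fun j : ℕ => (j : ℝ)) k

/-- Interpolation expresses a slice through its values at fixed nodes. These values depend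
continuously on the slice, whereas the polynomial is only given slice by slice. -/
theorem eval_eq_sum_nodeBasis {P : Polynomial ℂ} {n : ℕ} (hP : P.natDegree ≤ n) (s : ℝ) :
    P.eval (s : ℂ) = ∑ k ∈ Finset.range (n + 1),
      (((nodeBasis n k).eval s : ℝ) : ℂ) * P.eval ((k : ℝ) : ℂ) := by
  have hinj : InjOn (fun j : ℕ => (j : ℂ)) (Finset.range (n + 1)) :=
    fun a _ b _ h => Nat.cast_injective h
  have hdeg : P.degree < (Finset.range (n + 1)).card := by
    rw [Finset.card_range]
    exact lt_of_le_of_lt Polynomial.degree_le_natDegree (by exact_mod_cast Nat.lt_succ_of_le hP)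
  conv_lhs => rw [Lagrange.eq_interpolate hinj hdeg]
  rw [Lagrange.interpolate_apply, Polynomial.eval_finsetSum]
  refine Finset.sum_congr rfl fun k _ => ?_
  rw [Polynomial.eval_mul, Polynomial.eval_C, mul_comm]
  congr 1
  rw [nodeBasis, Lagrange.basis, Lagrange.basis, Polynomial.eval_prod, Polynomial.eval_prod,
    ofReal_prod]
  refine Finset.prod_congr rfl fun j _ => ?_
  simp [Lagrange.basisDivisor]

/-- The critical Gaussian case in the plane. -/
theorem fourier_eq_polynomial_of_hardy (d : ℕ) :
    ∃ n : ℕ, ∀ v : Plane → ℂ, AEStronglyMeasurable v →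
    (Integrable fun y => ‖v y‖ / (1 + ‖y‖) ^ d * Real.exp (Real.pi * ‖y‖ ^ 2)) →
    (Integrable fun x => ‖𝓕 v x‖ / (1 + ‖x‖) ^ d * Real.exp (Real.pi * ‖x‖ ^ 2)) →
    ∀ x : Plane, 𝓕 v x * Real.exp (Real.pi * ‖x‖ ^ 2) = ∑ k ∈ Finset.range (n + 1),
      ∑ l ∈ Finset.range (n + 1),
      (((nodeBasis n k).eval (x 0) * (nodeBasis n l).eval (x 1) : ℝ) : ℂ) *
        (𝓕 v !₂[(k : ℝ), (l : ℝ)] *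
          Real.exp (Real.pi * ‖(!₂[(k : ℝ), (l : ℝ)] : Plane)‖ ^ 2)) := by
  have hpq : (2 : ℝ).HolderConjugate 2 := Real.HolderConjugate.two_two
  obtain ⟨N, hN⟩ := norm_fourierSlice_le Plane hpq one_pos d
  refine ⟨N + d, fun v hv hint hint' x => ?_⟩
  have hint2 : Integrable fun y => ‖v y‖ / (1 + ‖y‖) ^ d *
      Real.exp (2 * Real.pi * ((1 : ℝ) ^ (2 : ℝ) / 2) * ‖y‖ ^ (2 : ℝ)) := by
    refine hint.congr (Eventually.of_forall fun y => ?_)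
    simp only [Real.rpow_two]
    congr 3; ring
  obtain ⟨C, hC⟩ := hN v hint2
  have hc := continuous_fourier (integrable_of_weighted hpq one_pos hv hint2)
  set G : Plane → ℂ := fun x => 𝓕 v x * Real.exp (Real.pi * ‖x‖ ^ 2) with hG
  have hGc : Continuous G := hc.mul (by fun_prop)
  set n := N + d with hn
  -- `gaussian_line` gives the identity for almost every `t`; both sides are continuous in `t`, so
  -- it holds for all. Applied in each variable in turn, it yields a joint polynomial.
  have hslice : ∀ (i : Fin 2) (t s : ℝ), G (coordPoint i t s) = ∑ k ∈ Finset.range (n + 1),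
      (((nodeBasis n k).eval s : ℝ) : ℂ) * G (coordPoint i t k) := by
    intro i t s
    have hae : ∀ᵐ t : ℝ, ∀ s : ℝ, G (coordPoint i t s) = ∑ k ∈ Finset.range (n + 1),
        (((nodeBasis n k).eval s : ℝ) : ℂ) * G (coordPoint i t k) := by
      have hint3 : Integrable fun x => ‖𝓕 v x‖ / (1 + ‖x‖) ^ d *
          Real.exp (Real.pi * ‖x‖ ^ (2 : ℝ)) := by simpa only [Real.rpow_two] using hint'
      filter_upwards [ae_integrable_weighted_slice hc Real.pi_pos.le (by norm_num) hint3 i]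
        with t ht s
      obtain ⟨P, hP, hPe⟩ := gaussian_line (N := N) (d := d) (b := Real.pi) (C := C)
        (differentiable_fourierSlice hpq one_pos hv hint2 (EuclideanSpace.single (1 - i) t)
          (norm_single_one_le i)) Real.pi_pos.le (fun z => by
            have := hC (EuclideanSpace.single (1 - i) t) _ (norm_single_one_le i) z
            rw [Real.rpow_two |z.im|, sq_abs, Real.one_rpow] at this
            convert this using 3
            ring) (by
            simpa only [fourierSlice_coordPoint, Real.rpow_two, sq_abs] using ht)
      have hGP : ∀ s : ℝ, G (coordPoint i t s) =
          Real.exp (Real.pi * t ^ 2) * P.eval (s : ℂ) := by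
        intro s
        rw [← hPe, fourierSlice_coordPoint, hG]
        simp only
        rw [norm_coordPoint_sq, mul_add, Real.exp_add]
        push_cast
        ring
      rw [hGP, eval_eq_sum_nodeBasis hP, Finset.mul_sum]
      refine Finset.sum_congr rfl fun k _ => ?_
      rw [hGP]; ring
    have h1 := (((hGc.comp (continuous_coordPoint_left i s)).ae_eq_iff_eq volume
      (g := fun t => ∑ k ∈ Finset.range (n + 1),
        (((nodeBasis n k).eval s : ℝ) : ℂ) * G (coordPoint i t k))
      (continuous_finsetSum _ fun k _ => continuous_const.mul
        (hGc.comp (continuous_coordPoint_left i k)))).1 (hae.mono fun t ht => ht s))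
    exact congrFun h1 t
  have hx : coordPoint 0 (x 1) (x 0) = x := by
    rw [coordPoint_zero]; ext j; fin_cases j <;> simp
  have h1 := hslice 0 (x 1) (x 0)
  rw [hx] at h1
  change G x = _
  rw [h1]
  refine Finset.sum_congr rfl fun k _ => ?_
  rw [coordPoint_zero, ← coordPoint_one, hslice 1, Finset.mul_sum]
  refine Finset.sum_congr rfl fun l _ => ?_
  rw [coordPoint_one, ofReal_mul, mul_assoc]

end Planar

/-! ### From the two-sided transform to the classical one. -/

/-- The quaternion `a + bi + cj + dk`. -/
def quat (a b c d : ℝ) : Quaternion ℝ := ⟨a, b, c, d⟩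

section

variable (a b c d : ℝ)

@[simp] theorem quat_re : (quat a b c d).re = a := rfl

@[simp] theorem quat_imI : (quat a b c d).imI = b := rfl

@[simp] theorem quat_imJ : (quat a b c d).imJ = c := rfl

@[simp] theorem quat_imK : (quat a b c d).imK = d := rfl

end

theorem expI_eq (θ : ℝ) : expI θ = quat (Real.cos θ) (Real.sin θ) 0 0 := rfl

theorem expJ_eq (θ : ℝ) : expJ θ = quat (Real.cos θ) 0 (Real.sin θ) 0 := rfl

theorem continuous_expI : Continuous expI := by
  have : expI = fun θ => Real.cos θ • quat 1 0 0 0 + Real.sin θ • quat 0 1 0 0 := by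
    funext θ
    apply Quaternion.ext <;> simp [expI_eq]
  rw [this]; fun_prop

theorem continuous_expJ : Continuous expJ := by
  have : expJ = fun θ => Real.cos θ • quat 1 0 0 0 + Real.sin θ • quat 0 0 1 0 := by
    funext θ
    apply Quaternion.ext <;> simp [expJ_eq]
  rw [this]; fun_prop

theorem norm_expI (θ : ℝ) : ‖expI θ‖ = 1 := by
  rw [← sq_eq_sq₀ (norm_nonneg _) zero_le_one, sq, ← Quaternion.normSq_eq_norm_mul_self,
    Quaternion.normSq_def']
  simp [expI_eq]

theorem norm_expJ (θ : ℝ) : ‖expJ θ‖ = 1 := by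
  rw [← sq_eq_sq₀ (norm_nonneg _) zero_le_one, sq, ← Quaternion.normSq_eq_norm_mul_self,
    Quaternion.normSq_def']
  simp [expJ_eq]

theorem norm_sq_quaternion (a : Quaternion ℝ) :
    ‖a‖ ^ 2 = a.re ^ 2 + a.imI ^ 2 + a.imJ ^ 2 + a.imK ^ 2 := by
  rw [sq, ← Quaternion.normSq_eq_norm_mul_self, Quaternion.normSq_def']

/-- The real-linear map carrying the two-sided transform of a real function to its classical
Fourier transform. -/
noncomputable def toClassical : Quaternion ℝ →ₗ[ℝ] ℂ where
  toFun a := ⟨a.re - a.imK, a.imI + a.imJ⟩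
  map_add' a b := by apply Complex.ext <;> simp <;> ring
  map_smul' r a := by apply Complex.ext <;> simp <;> ring

theorem norm_toClassical_le (a : Quaternion ℝ) : ‖toClassical a‖ ≤ √2 * ‖a‖ := by
  refine le_of_sq_le_sq ?_ (by positivity)
  rw [mul_pow, Real.sq_sqrt (by norm_num), norm_sq_quaternion, ← Complex.normSq_eq_norm_sq,
    Complex.normSq_apply]
  simp only [toClassical, LinearMap.coe_mk, AddHom.coe_mk]
  nlinarith [sq_nonneg (a.re + a.imK), sq_nonneg (a.imI - a.imJ)]

/-- `toClassical` sends `i` and `j` to `i` and `k = ij` to `-1`, so the two exponentials merge into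
a single complex one. -/
theorem toClassical_kernel (a b r : ℝ) :
    toClassical (expI (-a) * (r : Quaternion ℝ) * expJ (-b)) =
      cexp (((-(a + b) : ℝ) : ℂ) * I) * r := by
  rw [Complex.exp_mul_I, ← ofReal_cos, ← ofReal_sin, Real.cos_neg, Real.sin_neg, Real.cos_add,
    Real.sin_add]
  rw [expI_eq, expJ_eq, Real.cos_neg, Real.cos_neg, Real.sin_neg, Real.sin_neg]
  apply Complex.ext
  · simp [toClassical, -ofReal_cos, -ofReal_sin, -ofReal_add, -ofReal_sub, -ofReal_mul]
    ring
  · simp [toClassical, -ofReal_cos, -ofReal_sin, -ofReal_add, -ofReal_sub, -ofReal_mul]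
    ring

theorem integrable_qft_kernel {f : Plane → Quaternion ℝ} (hf : Integrable f) (ξ : Plane) :
    Integrable fun x : Plane =>
      expI (-(2 * Real.pi * ξ 0 * x 0)) * f x * expJ (-(2 * Real.pi * ξ 1 * x 1)) := by
  refine hf.norm.mono' ?_ (Eventually.of_forall fun x => ?_)
  · refine AEStronglyMeasurable.mul (AEStronglyMeasurable.mul ?_ hf.1) ?_
    · exact (continuous_expI.comp (by fun_prop)).aestronglyMeasurable
    · exact (continuous_expJ.comp (by fun_prop)).aestronglyMeasurable
  · rw [norm_mul, norm_mul, norm_expI, norm_expJ, one_mul, mul_one]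

theorem norm_fourier_le_qft {u : Plane → ℝ} (hu : Integrable u) (ξ : Plane) :
    ‖𝓕 (fun x => (u x : ℂ)) ξ‖ ≤ √2 * ‖qft (fun x => (u x : Quaternion ℝ)) ξ‖ := by
  have hu' : Integrable fun x => (u x : Quaternion ℝ) := by
    refine hu.mono ?_ (Eventually.of_forall fun x => ?_)
    · exact Quaternion.continuous_coe.comp_aestronglyMeasurable hu.1
    · rw [Quaternion.norm_coe]
  have h1 : 𝓕 (fun x => (u x : ℂ)) ξ = toClassical (qft (fun x => (u x : Quaternion ℝ)) ξ) := by
    have h2 := (LinearMap.toContinuousLinearMap toClassical).integral_comp_comm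
      (integrable_qft_kernel hu' ξ)
    rw [qft, ← LinearMap.coe_toContinuousLinearMap' toClassical, ← h2, Real.fourier_eq']
    congr 1
    ext x
    rw [LinearMap.coe_toContinuousLinearMap', toClassical_kernel, smul_eq_mul]
    congr 4
    rw [PiLp.inner_apply, Fin.sum_univ_two]
    simp
    ring
  rw [h1]
  exact norm_toClassical_le _

theorem norm_le_qftModulus (f : Plane → Quaternion ℝ) (ξ : Plane) :
    (‖qft (fun x => (((f x).re : ℝ) : Quaternion ℝ)) ξ‖ ≤ qftModulus f ξ ∧
      ‖qft (fun x => (((f x).imI : ℝ) : Quaternion ℝ)) ξ‖ ≤ qftModulus f ξ) ∧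
    (‖qft (fun x => (((f x).imJ : ℝ) : Quaternion ℝ)) ξ‖ ≤ qftModulus f ξ ∧
      ‖qft (fun x => (((f x).imK : ℝ) : Quaternion ℝ)) ξ‖ ≤ qftModulus f ξ) := by
  unfold qftModulus
  refine ⟨⟨?_, ?_⟩, ?_, ?_⟩ <;> refine Real.le_sqrt_of_sq_le ?_ <;>
  nlinarith [sq_nonneg ‖qft (fun x => (((f x).re : ℝ) : Quaternion ℝ)) ξ‖,
    sq_nonneg ‖qft (fun x => (((f x).imI : ℝ) : Quaternion ℝ)) ξ‖,
    sq_nonneg ‖qft (fun x => (((f x).imJ : ℝ) : Quaternion ℝ)) ξ‖,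
    sq_nonneg ‖qft (fun x => (((f x).imK : ℝ) : Quaternion ℝ)) ξ‖]

/-! ### Scalar Gelfand–Shilov pairs. -/

/-- A function on the plane which, together with its Fourier transform, satisfies the
Gelfand–Shilov integrability conditions. -/
structure GelfandShilov (d : ℕ) (α β p q : ℝ) (u : Plane → ℂ) : Prop where
  meas : AEStronglyMeasurable u
  int : Integrable fun x => ‖u x‖ / (1 + ‖x‖) ^ d *
    Real.exp (2 * Real.pi * (α ^ p / p) * ‖x‖ ^ p)
  int_fourier : Integrable fun y => ‖𝓕 u y‖ / (1 + ‖y‖) ^ d *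
    Real.exp (2 * Real.pi * (β ^ q / q) * ‖y‖ ^ q)

namespace GelfandShilov

variable {d : ℕ} {α β p q : ℝ} {u : Plane → ℂ}

theorem integrable (h : GelfandShilov d α β p q u) (hpq : p.HolderConjugate q) (hα : 0 < α) :
    Integrable u := integrable_of_weighted hpq.symm hα h.meas h.int

theorem continuous_fourier (h : GelfandShilov d α β p q u) (hpq : p.HolderConjugate q)
    (hα : 0 < α) : Continuous (𝓕 u) := QuaternionFourier.continuous_fourier (h.integrable hpq hα)

theorem integrable_fourier (h : GelfandShilov d α β p q u) (hpq : p.HolderConjugate q)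
    (hα : 0 < α) (hβ : 0 < β) : Integrable (𝓕 u) :=
  integrable_of_weighted hpq hβ (h.continuous_fourier hpq hα).aestronglyMeasurable h.int_fourier

theorem ae_eq (h : GelfandShilov d α β p q u) (hpq : p.HolderConjugate q)
    (hα : 0 < α) (hβ : 0 < β) : ∀ᵐ x, u x = 𝓕 (𝓕 u) (-x) :=
  ae_eq_fourierInv_fourier (h.integrable hpq hα) (h.integrable_fourier hpq hα hβ)

theorem int_fourier_fourier (h : GelfandShilov d α β p q u) (hpq : p.HolderConjugate q)
    (hα : 0 < α) (hβ : 0 < β) : Integrable fun x => ‖𝓕 (𝓕 u) x‖ / (1 + ‖x‖) ^ d *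
      Real.exp (2 * Real.pi * (α ^ p / p) * ‖x‖ ^ p) := by
  have h1 := (h.int.congr ((h.ae_eq hpq hα hβ).mono fun x hx => by
    simp only [hx]; rfl) : Integrable fun x => ‖𝓕 (𝓕 u) (-x)‖ / (1 + ‖x‖) ^ d *
      Real.exp (2 * Real.pi * (α ^ p / p) * ‖x‖ ^ p)).comp_neg
  simpa using h1

theorem ae_eq_zero_of_fourier (h : GelfandShilov d α β p q u) (hpq : p.HolderConjugate q)
    (hα : 0 < α) (hβ : 0 < β) (h0 : 𝓕 (𝓕 u) = 0) : u =ᵐ[volume] 0 :=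
  (h.ae_eq hpq hα hβ).mono fun x hx => by rw [hx, h0]; rfl

/-- The line theorems need the exponent of the decaying side to be at most 2. For `p < 2` they apply
to 𝓕u, whose transform is `u` reflected; for `p > 2` one has `q < 2` and they apply to `u` itself.
For `p = 2` the condition `αβ > 1` is exactly the strict Hardy inequality. -/
theorem ae_eq_zero (h : GelfandShilov d α β p q u) (hpq : p.HolderConjugate q)
    (hα : 1 ≤ α) (hβ : 1 ≤ β) (hcond : p ≠ 2 ∨ 1 < α * β) : u =ᵐ[volume] 0 := by
  have hα0 : 0 < α := by linarith
  have hβ0 : 0 < β := by linarith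
  have hp := hpq.lt
  have hq := hpq.symm.lt
  -- Both sides are compared with `2π / r`; this is where `α, β ≥ 1` enters.
  have hmono : ∀ {r a b : ℝ}, 1 < r → 1 ≤ a → 1 ≤ b →
      2 * Real.pi / (r * a ^ r) ≤ 2 * Real.pi * (b ^ r / r) := by
    intro r a b hr ha hb
    have h1 : 1 ≤ a ^ r := Real.one_le_rpow ha (by linarith)
    have h2 : 1 ≤ b ^ r := Real.one_le_rpow hb (by linarith)
    have h3 : 2 * Real.pi / (r * a ^ r) ≤ 2 * Real.pi / r := by
      gcongr
      exact le_mul_of_one_le_right (by linarith) h1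
    refine h3.trans ?_
    rw [mul_div_assoc' (2 * Real.pi)]
    have h4 : 2 * Real.pi ≤ 2 * Real.pi * b ^ r := le_mul_of_one_le_right (by positivity) h2
    gcongr
  have hzero : 𝓕 u = 0 → u =ᵐ[volume] 0 := fun h0 => by
    refine h.ae_eq_zero_of_fourier hpq hα0 hβ0 ?_
    rw [h0]
    ext x
    rw [Real.fourier_eq']
    simp
  rcases lt_trichotomy p 2 with h2 | h2 | h2
  · refine h.ae_eq_zero_of_fourier hpq hα0 hβ0 ?_
    exact fourier_eq_zero_of_morgan hpq h2 hβ0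
      (h.continuous_fourier hpq hα0).aestronglyMeasurable h.int_fourier
      (h.int_fourier_fourier hpq hα0 hβ0) (hmono hp hβ hα)
  · have hαβ := hcond.resolve_left (not_not.2 h2)
    have hq2 : q = 2 := by
      have := hpq.sub_one_mul_conj
      rw [h2] at this
      linarith
    refine hzero ?_
    have hint := h.int
    have hint' := h.int_fourier
    rw [h2] at hint
    rw [hq2] at hint'
    refine fourier_eq_zero_of_hardy hα0 h.meas hint hint' ?_
    rw [Real.rpow_two, Real.rpow_two, div_lt_iff₀ (by positivity)]
    have h3 : 1 < (α * β) ^ 2 := one_lt_pow₀ hαβ (by norm_num)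
    have := mul_lt_mul_of_pos_left h3 (by positivity : 0 < 2 * Real.pi)
    calc 2 * Real.pi < 2 * Real.pi * (α * β) ^ 2 := by linarith
      _ = _ := by ring
  · refine hzero ?_
    have hq2 : q < 2 := by
      have := hpq.sub_one_mul_conj
      nlinarith
    exact fourier_eq_zero_of_morgan hpq.symm hq2 hα0 h.meas h.int h.int_fourier (hmono hq hα hβ)

end GelfandShilov

/-- The critical Hardy theorem applied to 𝓕u; inversion reflects the argument, hence the nodes
evaluated at `-x`. The bound `n` is common to all `u`, so the four components of `f` share one
basis. -/
theorem exists_polynomial_of_gelfandShilov (d : ℕ) : ∃ (n : ℕ), ∀ u : Plane → ℂ,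
    GelfandShilov d 1 1 2 2 u → ∃ W : ℕ → ℕ → ℂ, ∀ᵐ x : Plane,
      u x * Real.exp (Real.pi * ‖x‖ ^ 2) = ∑ k ∈ Finset.range (n + 1),
        ∑ l ∈ Finset.range (n + 1),
        (((nodeBasis n k).eval (-x 0) * (nodeBasis n l).eval (-x 1) : ℝ) : ℂ) * W k l := by
  obtain ⟨n, hn⟩ := fourier_eq_polynomial_of_hardy d
  refine ⟨n, fun u h => ?_⟩
  have hpq : (2 : ℝ).HolderConjugate 2 := Real.HolderConjugate.two_two
  have hw : ∀ x : Plane, 2 * Real.pi * ((1 : ℝ) ^ (2 : ℝ) / 2) * ‖x‖ ^ (2 : ℝ) =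
      Real.pi * ‖x‖ ^ 2 := by
    intro x
    rw [Real.one_rpow, Real.rpow_two]; ring
  have h1 := h.int_fourier
  have h2 := h.int_fourier_fourier hpq one_pos one_pos
  simp only [hw] at h1 h2
  refine ⟨fun k l => 𝓕 (𝓕 u) !₂[(k : ℝ), (l : ℝ)] *
    Real.exp (Real.pi * ‖(!₂[(k : ℝ), (l : ℝ)] : Plane)‖ ^ 2), (h.ae_eq hpq one_pos one_pos).mono fun x hx => ?_⟩
  rw [hx, ← norm_neg x,
    hn (𝓕 u) (h.continuous_fourier hpq one_pos).aestronglyMeasurable h1 h2 (-x)]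
  rfl

/-! ### Assembling the quaternion polynomial. -/

theorem QPoly.eval_add (P Q : QPoly) (x : Plane) : (P + Q : QPoly).eval x = P.eval x + Q.eval x :=
  Finsupp.sum_add_index' (fun _ => smul_zero _) fun _ _ _ => smul_add _ _ _

theorem QPoly.eval_sum {ι : Type*} (s : Finset ι) (P : ι → QPoly) (x : Plane) :
    QPoly.eval (∑ i ∈ s, P i) x = ∑ i ∈ s, (P i).eval x := by
  classical
  induction s using Finset.induction_on with
  | empty => simp [QPoly.eval]
  | insert i s hi ih => rw [Finset.sum_insert hi, Finset.sum_insert hi, QPoly.eval_add, ih]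

theorem QPoly.exists_eval_eq (A B : Polynomial ℝ) (w : Quaternion ℝ) :
    ∃ P : QPoly, ∀ x : Plane, P.eval x = (A.eval (x 0) * B.eval (x 1)) • w := by
  refine ⟨∑ i ∈ A.support, ∑ j ∈ B.support, Finsupp.single (i, j) ((A.coeff i * B.coeff j) • w),
    fun x => ?_⟩
  rw [QPoly.eval_sum, Polynomial.eval_eq_sum, Polynomial.eval_eq_sum, Polynomial.sum,
    Polynomial.sum, Finset.sum_mul_sum, Finset.sum_smul]
  refine Finset.sum_congr rfl fun i _ => ?_
  rw [QPoly.eval_sum, Finset.sum_smul]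
  refine Finset.sum_congr rfl fun j _ => ?_
  have h1 : QPoly.eval (Finsupp.single (i, j) ((A.coeff i * B.coeff j) • w)) x =
      (x 0 ^ i * x 1 ^ j) • ((A.coeff i * B.coeff j) • w) :=
    Finsupp.sum_single_index (smul_zero _)
  rw [h1, smul_smul]
  congr 1
  ring

theorem gelfandShilov_component {d : ℕ} {α β p q : ℝ} (hpq : p.HolderConjugate q) (hα : 0 < α)
    {f : Plane → Quaternion ℝ} (hf : AEStronglyMeasurable f)
    (h_f : Integrable fun x : Plane =>
      ‖f x‖ / (1 + ‖x‖) ^ d * Real.exp (2 * Real.pi * (α ^ p / p) * ‖x‖ ^ p))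
    (h_qft : Integrable fun y : Plane => qftModulus f y / (1 + ‖y‖) ^ d
        * Real.exp (2 * Real.pi * (β ^ q / q) * ‖y‖ ^ q))
    {c : Quaternion ℝ → ℝ} (hc : Continuous c) (hcn : ∀ a, |c a| ≤ ‖a‖)
    (hcq : ∀ ξ, ‖qft (fun x => ((c (f x) : ℝ) : Quaternion ℝ)) ξ‖ ≤ qftModulus f ξ) :
    GelfandShilov d α β p q fun x => (c (f x) : ℂ) := by
  have hm : AEStronglyMeasurable fun x => (c (f x) : ℂ) :=
    (continuous_ofReal.comp hc).comp_aestronglyMeasurable hf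
  have hi : Integrable fun x => ‖(c (f x) : ℂ)‖ / (1 + ‖x‖) ^ d *
      Real.exp (2 * Real.pi * (α ^ p / p) * ‖x‖ ^ p) := by
    refine h_f.mono' ?_ (Eventually.of_forall fun x => ?_)
    · have h1 : Continuous fun x : Plane => ((1 + ‖x‖) ^ d)⁻¹ :=
        Continuous.inv₀ (by fun_prop) fun x => by positivity
      simp only [div_eq_mul_inv]
      exact (hm.norm.mul h1.aestronglyMeasurable).mul
        (Measurable.aestronglyMeasurable (by fun_prop))
    · rw [Real.norm_of_nonneg (by positivity), norm_real, Real.norm_eq_abs]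
      have := hcn (f x)
      gcongr
  have hint := integrable_of_weighted hpq.symm hα hm hi
  have hintr : Integrable fun x => c (f x) := by
    simpa using! hint.re
  refine ⟨hm, hi, (h_qft.const_mul √2).mono' ?_ (Eventually.of_forall fun y => ?_)⟩
  · refine AEStronglyMeasurable.mul ?_ (Measurable.aestronglyMeasurable (by fun_prop))
    exact ((continuous_fourier hint).norm.div (by fun_prop)
      fun s => by positivity).aestronglyMeasurable
  · have h1 := (norm_fourier_le_qft hintr y).trans
      (mul_le_mul_of_nonneg_left (hcq y) (Real.sqrt_nonneg 2))
    have h2 : ‖𝓕 (fun x => (c (f x) : ℂ)) y‖ / (1 + ‖y‖) ^ d ≤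
        √2 * (qftModulus f y / (1 + ‖y‖) ^ d) := by
      rw [mul_div_assoc']
      gcongr
    rw [Real.norm_of_nonneg (by positivity), ← mul_assoc]
    gcongr

theorem abs_components_le_norm (a : Quaternion ℝ) :
    (|a.re| ≤ ‖a‖ ∧ |a.imI| ≤ ‖a‖) ∧ (|a.imJ| ≤ ‖a‖ ∧ |a.imK| ≤ ‖a‖) := by
  have h := norm_sq_quaternion a
  refine ⟨⟨?_, ?_⟩, ?_, ?_⟩ <;> refine abs_le_of_sq_le_sq ?_ (norm_nonneg _) <;>
  nlinarith [sq_nonneg a.re, sq_nonneg a.imI, sq_nonneg a.imJ, sq_nonneg a.imK]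

end QuaternionFourier

open QuaternionFourier MeasureTheory in
theorem corollary5p3 (d : ℕ) (α β p q : ℝ) (hα : 1 ≤ α) (hβ : 1 ≤ β)
    (hp : 1 < p) (hq : 1 < q) (hpq : 1 / p + 1 / q = 1)
    (f : QuaternionFourier.Plane → Quaternion ℝ)
    (hf : MeasureTheory.MemLp f 2 MeasureTheory.volume)
    (h_f : MeasureTheory.Integrable (fun x : QuaternionFourier.Plane =>
      ‖f x‖ / (1 + ‖x‖) ^ d * Real.exp (2 * Real.pi * (α ^ p / p) * ‖x‖ ^ p))
      MeasureTheory.volume)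
    (h_qft : MeasureTheory.Integrable (fun y : QuaternionFourier.Plane =>
      QuaternionFourier.qftModulus f y / (1 + ‖y‖) ^ d
        * Real.exp (2 * Real.pi * (β ^ q / q) * ‖y‖ ^ q))
      MeasureTheory.volume) :
    (((p, q) ≠ ((2, 2) : ℝ × ℝ) ∨ 1 < α * β) → f =ᵐ[MeasureTheory.volume] 0) ∧
    (¬ ((p, q) ≠ ((2, 2) : ℝ × ℝ) ∨ 1 < α * β) →
      ∃ P : QuaternionFourier.QPoly, P.degree + 2 < (d : WithBot ℕ) ∧
        ∀ᵐ x : QuaternionFourier.Plane ∂MeasureTheory.volume,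
          f x = Real.exp (-(Real.pi * α ^ 2 * ‖x‖ ^ 2)) • P.eval x) := by
  have hconj : p.HolderConjugate q :=
    Real.holderConjugate_iff.2 ⟨hp, by simpa only [one_div] using hpq⟩
  have hα0 : 0 < α := by linarith
  have h0 := gelfandShilov_component hconj hα0 hf.1 h_f h_qft Quaternion.continuous_re
    (fun a => (abs_components_le_norm a).1.1) fun ξ => (norm_le_qftModulus f ξ).1.1
  have h1 := gelfandShilov_component hconj hα0 hf.1 h_f h_qft Quaternion.continuous_imI
    (fun a => (abs_components_le_norm a).1.2) fun ξ => (norm_le_qftModulus f ξ).1.2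
  have h2 := gelfandShilov_component hconj hα0 hf.1 h_f h_qft Quaternion.continuous_imJ
    (fun a => (abs_components_le_norm a).2.1) fun ξ => (norm_le_qftModulus f ξ).2.1
  have h3 := gelfandShilov_component hconj hα0 hf.1 h_f h_qft Quaternion.continuous_imK
    (fun a => (abs_components_le_norm a).2.2) fun ξ => (norm_le_qftModulus f ξ).2.2
  refine ⟨fun hcond => ?_, fun hcond => ?_⟩
  · have hcond' : p ≠ 2 ∨ 1 < α * β := by
      refine hcond.imp_left fun hne hp2 => hne ?_
      have := hconj.sub_one_mul_conj
      rw [hp2] at this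
      rw [hp2, show q = 2 by linarith]
    filter_upwards [h0.ae_eq_zero hconj hα hβ hcond', h1.ae_eq_zero hconj hα hβ hcond',
      h2.ae_eq_zero hconj hα hβ hcond', h3.ae_eq_zero hconj hα hβ hcond'] with x e0 e1 e2 e3
    exact Quaternion.ext _ _ (Complex.ofReal_eq_zero.1 e0) (Complex.ofReal_eq_zero.1 e1)
      (Complex.ofReal_eq_zero.1 e2) (Complex.ofReal_eq_zero.1 e3)
  · push Not at hcond
    obtain ⟨hpq2, hαβ⟩ := hcond
    obtain ⟨rfl, rfl⟩ := Prod.mk.inj hpq2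
    -- From `αβ ≤ 1` and `α, β ≥ 1`, both equal 1.
    obtain rfl : α = 1 := le_antisymm (by nlinarith) hα
    obtain rfl : β = 1 := le_antisymm (by linarith) hβ
    obtain ⟨n, hn⟩ := exists_polynomial_of_gelfandShilov d
    obtain ⟨W0, hW0⟩ := hn _ h0
    obtain ⟨W1, hW1⟩ := hn _ h1
    obtain ⟨W2, hW2⟩ := hn _ h2
    obtain ⟨W3, hW3⟩ := hn _ h3
    set A : ℕ → Polynomial ℝ := fun k => (nodeBasis n k).comp (-Polynomial.X) with hA
    have hAe : ∀ (k : ℕ) (s : ℝ), (A k).eval s = (nodeBasis n k).eval (-s) := by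
      intro k s; simp [hA]
    choose P hP using fun k l => QPoly.exists_eval_eq (A k) (A l)
      (quat (W0 k l).re (W1 k l).re (W2 k l).re (W3 k l).re)
    set Q : QPoly := ∑ k ∈ Finset.range (n + 1), ∑ l ∈ Finset.range (n + 1), P k l with hQ
    have hQe : ∀ x : Plane, Q.eval x = ∑ k ∈ Finset.range (n + 1), ∑ l ∈ Finset.range (n + 1),
        ((nodeBasis n k).eval (-x 0) * (nodeBasis n l).eval (-x 1)) •
          quat (W0 k l).re (W1 k l).re (W2 k l).re (W3 k l).re := by
      intro x
      simp only [hQ, QPoly.eval_sum, hP, hAe]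
    -- The components and the basis polynomials are real, so only the real parts of the weights
    -- contribute.
    have hre : ∀ (x : Plane) (W : ℕ → ℕ → ℂ) (r : ℝ),
        (r : ℂ) * Real.exp (Real.pi * ‖x‖ ^ 2) = ∑ k ∈ Finset.range (n + 1),
          ∑ l ∈ Finset.range (n + 1),
          (((nodeBasis n k).eval (-x 0) * (nodeBasis n l).eval (-x 1) : ℝ) : ℂ) * W k l →
        Real.exp (Real.pi * ‖x‖ ^ 2) * r = ∑ k ∈ Finset.range (n + 1),
          ∑ l ∈ Finset.range (n + 1),
          ((nodeBasis n k).eval (-x 0) * (nodeBasis n l).eval (-x 1)) * (W k l).re := by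
      intro x W r h
      have := congrArg Complex.re h
      simp only [Complex.re_sum, Complex.re_ofReal_mul, Complex.ofReal_re] at this
      rw [mul_comm, this]
    have hfQ : ∀ᵐ x : Plane, Real.exp (Real.pi * ‖x‖ ^ 2) • f x = Q.eval x := by
      filter_upwards [hW0, hW1, hW2, hW3] with x e0 e1 e2 e3
      rw [hQe]
      have r0 := hre x W0 _ e0
      have r1 := hre x W1 _ e1
      have r2 := hre x W2 _ e2
      have r3 := hre x W3 _ e3
      have hsum : ∀ (g : Quaternion ℝ →+ ℝ), g (∑ k ∈ Finset.range (n + 1),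
          ∑ l ∈ Finset.range (n + 1), ((nodeBasis n k).eval (-x 0) * (nodeBasis n l).eval (-x 1)) •
            quat (W0 k l).re (W1 k l).re (W2 k l).re (W3 k l).re) =
          ∑ k ∈ Finset.range (n + 1), ∑ l ∈ Finset.range (n + 1),
            g (((nodeBasis n k).eval (-x 0) * (nodeBasis n l).eval (-x 1)) •
              quat (W0 k l).re (W1 k l).re (W2 k l).re (W3 k l).re) := by
        intro g; simp only [map_sum]
      refine Quaternion.ext _ _ ?_ ?_ ?_ ?_
      · exact r0.trans (hsum ⟨⟨fun a => a.re, rfl⟩, fun _ _ => rfl⟩).symm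
      · exact r1.trans (hsum ⟨⟨fun a => a.imI, rfl⟩, fun _ _ => rfl⟩).symm
      · exact r2.trans (hsum ⟨⟨fun a => a.imJ, rfl⟩, fun _ _ => rfl⟩).symm
      · exact r3.trans (hsum ⟨⟨fun a => a.imK, rfl⟩, fun _ _ => rfl⟩).symm
    -- The Gaussian weight cancels exactly, so the hypothesis on `f` says that `‖Q‖ / (1 + ‖x‖)^d`
    -- is integrable.
    refine ⟨Q, Q.degree_lt_of_integrable ?_, ?_⟩
    · refine h_f.congr (hfQ.mono fun x hx => ?_)
      simp only [← hx, norm_smul, Real.norm_of_nonneg (Real.exp_pos _).le]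
      rw [Real.one_rpow, Real.rpow_two,
        show 2 * Real.pi * (1 / 2) * ‖x‖ ^ 2 = Real.pi * ‖x‖ ^ 2 by ring]
      ring
    · refine hfQ.mono fun x hx => ?_
      rw [← hx, smul_smul, ← Real.exp_add]
      simp
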